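/- \textbf{Setting.} Let $\mathcal N$ (stations), $\mathcal P$ (passenger requests), $\mathcal S$ (demand scenarios), $\mathcal L$ (lines) and, for each $\ell\in\mathcal L$, $\mathcal T_\ell$ (departure periods) be finite sets, and let $\mathcal E\subseteq\mathcal N\times\mathcal N$ be the roads, with travel times $tt(\cdot)>0$. Line $\ell$ has $I_\ell\ge 2$ distinct checkpoints $1,\dots,I_\ell$ and vehicle capacity $C_\ell\in\mathbb N$. Trip $(\ell,t)$ is scheduled at checkpoint $i$ at time $T_{\ell t}(i)\ge 0$, strictly increasing in $i$. Request $p$ has $D_{ps}\in\mathbb N$ passengers in scenario $s$, and can be served by $(\ell,t)$ only if $|T_{\ell t}(I_\ell)-t_p^{\rm req}|\le\alpha$ (then $p$ is \emph{compatible} with the trip). $\Gamma_\ell$ is the set of pairs $i<j$ with $j-i\le K+1$, and $\mathcal N_{ij}$ is the set of stations within distance $\Delta$ of the stretch of line $\ell$ from $i$ to $j$. Fix parameters $\lambda,\mu,\sigma,\delta,M\in\mathbb R$. A \emph{segment} $e$ of trip $(\ell,t)$ in scenario $s$ is a road together with a set $\mathcal P_e$ of compatible requests picked up on it. A passenger $p\in\mathcal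 P_e$ has walking, waiting and in-vehicle times $\tau^{\rm walk}_{ep}\le\Omega$, $0\le\tau^{\rm wait}_{ep}\le\Psi$, $\tau^{\rm travel}_{ep}$, which depend only on the trip, $s$, $e$ and $p$. Picking up $p$ on $e$ costs $$D_{ps}\Big(\lambda\tau^{\rm walk}_{ep}+\mu\tau^{\rm wait}_{ep}+\sigma\tfrac{\tau^{\rm travel}_{ep}}{\tau^{\rm dir}_p}+\delta\tfrac{\tau^{\rm late}_{\ell tp}}{\tau^{\rm dir}_p}+\tfrac\delta2\tfrac{\tau^{\rm early}_{\ell tp}}{\tau^{\rm dir}_p}-M\Big),\qquad \tau^{\rm dir}_p>0 .$$ The cost of a segment, subpath or path is the sum of the costs of its pickups. A \emph{subpath} $r$ consists of a pair $(u_r,v_r)\in\Gamma_\ell$ and a walk of segments from checkpoint $u_r$ to checkpoint $v_r$ with all stations in $\mathcal N_{u_rv_r}$, pairwise disjoint pickup sets with union $\mathcal P_r$, load $\sum_{p\in\mathcal P_r}D_{ps}\le C_\ell$, and travel time (the sum of $tt$ over its segments) at most $T_{\ell t}(v_r)-T_{\ell t}(u_r)$. A \emph{path} is a sequence of consecutive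 subpaths from checkpoint $1$ to checkpoint $I_\ell$ with total load at most $C_\ell$. Fix a scenario $s$ and first-stage decisions $x=(x_{\ell t})$, $z=(z_{\ell pt})$. In each formulation below, the constraints hold for every trip $(\ell,t)$, the objective is the total cost, summed over all trips, and the variables are binary. The \emph{linear relaxation} replaces $\{0,1\}$ by $[0,1]$. \emph{Path-based formulation.} Variables $\zeta_q$, one per path $q$. The $\zeta_q$ sum to $x_{\ell t}$. For each compatible $p$, the sum of the $\zeta_q$, weighted by the number of times that $q$ picks up $p$, is at most $z_{\ell pt}$. \emph{Subpath-based formulation.} The load-expanded network has the nodes (checkpoint, load $c\in\{0,\dots,C_\ell\}$) and a sink. For each subpath $r$ there are arcs from $(u_r,c)$ to $(v_r,c+\sum_{p\in\mathcal P_r}D_{ps})$ for all admissible $c$, with the cost of $r$; there are arcs of cost $0$ from all $(I_\ell,c)$ to the sink. The variables $y_a$, one per arc, form a flow of value $x_{\ell t}$ from $(1,0)$ to the sink. For each compatible $p$, the total flow on arcs whose subpath serves $p$ is at most $z_{\ell pt}$. \emph{Segment-based formulation with time step $\rho$.} Times are the multiples $0,\rho,2\rho,\dots$ up to the arrival of the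 last trip. The time-load-expanded network has the nodes (station, load, time) and a sink. Its arcs are: for each segment, traveling arcs with the load increased by the number of passengers picked up, the time increased by the travel time rounded up to a multiple of $\rho$, and the cost of the segment; idling arcs over one time step; and terminating arcs from the last checkpoint to the sink (these two kinds cost $0$). The variables are $\xi_a$, one per arc, and $\beta_{ij}$, one per trip and $(i,j)\in\Gamma_\ell$. Constraints: $\xi$ is a flow of value $x_{\ell t}$ from (checkpoint $1$, load $0$, $T_{\ell t}(1)$) to the sink; for each compatible $p$, the total $\xi$ on arcs that pick up $p$ is at most $z_{\ell pt}$; $\beta$ is a flow of value $x_{\ell t}$ from checkpoint $1$ to checkpoint $I_\ell$; for each checkpoint $j\neq1$, the total $\xi$ on arcs arriving at the station of $j$ at time $T_{\ell t}(j)$ is at least $\sum_{i}\beta_{ij}$; and, for each traveling or idling arc $a$, $\xi_a$ is at most the sum of those $\beta_{ij}$ for which both ends of $a$ have their stations in $\mathcal N_{ij}$ and their times in $[T_{\ell t}(i),T_{\ell t}(j)]$. Two formulations are \emph{equivalent} for $(s,x,z)$ if every feasible solution of either one can be matched by a feasible solution of the other one with the same objective value. \textbf{Proposition.} (1) For every scenario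 $s$ and all binary $x,z$, the path-based and the subpath-based formulation are equivalent. (2) For every $s$ and all $x,z$ with entries in $[0,1]$, their linear relaxations are equivalent as well, so they have the same optimal value. (3) Suppose that all scheduled times are integer multiples of a common unit $b>0$, and that for every trip, every scenario and every subpath $r$ the travel time is strictly less than $T_{\ell t}(v_r)-T_{\ell t}(u_r)$. Then there is a time step $\rho>0$, depending on neither $s$ nor $(x,z)$, such that all scheduled times are multiples of $\rho$ and the following holds. For every $s$ and all binary $x,z$, the segment-based formulation with time step $\rho$ is equivalent to the subpath-based formulation. For every $s$ and all $x,z$ with entries in $[0,1]$, every feasible solution of the linear relaxation of the subpath-based formulation is matched by a feasible solution of the linear relaxation of the segment-based formulation with the same objective value; so the latter relaxation is at most as strong. -/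

import Mathlib

noncomputable section

open scoped Classical

/-- A load-augmented road segment: a pair of stations (the road from the first one to the second
one) together with the set of passenger requests that are picked up on it. -/
abbrev Seg (N P : Type*) := (N × N) × Finset P

/-- The road of a load-augmented segment. -/
abbrev Seg.road {N P : Type*} (e : Seg N P) : N × N := e.1

/-- The set of passenger requests picked up on a load-augmented segment. -/
abbrev Seg.pax {N P : Type*} (e : Seg N P) : Finset P := e.2

/-- `IsWalk u v w`: the list of segments `w` is a walk from station `u` to station `v`. -/
def IsWalk {N P : Type*} : N → N → List (Seg N P) → Prop
  | u, v, [] => u = v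
  | u, v, e :: w => e.road.1 = u ∧ IsWalk e.road.2 v w

/-- Input data of the second-stage problem: stations `N`, passenger requests `P`, demand scenarios
`S`, reference lines `L`, and the departure periods `Dep ℓ` of the line `ℓ`. -/
structure MiND (N P S L : Type*) (Dep : L → Type*) where
  /-- roadways -/
  roads : Finset (N × N)
  /-- travel times of roadways -/
  tt : N × N → ℝ
  tt_pos : ∀ e ∈ roads, 0 < tt e
  /-- number of checkpoints of a line -/
  nCP : L → ℕ
  two_le_nCP : ∀ ℓ, 2 ≤ nCP ℓ
  /-- the checkpoints of a line, in order -/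
  cp : ∀ ℓ, Fin (nCP ℓ) → N
  cp_injective : ∀ ℓ, Function.Injective (cp ℓ)
  /-- scheduled time of a reference trip at a checkpoint, counted from a common time origin -/
  sched : ∀ ℓ, Dep ℓ → Fin (nCP ℓ) → ℝ
  sched_nonneg : ∀ ℓ t i, 0 ≤ sched ℓ t i
  sched_strictMono : ∀ ℓ t, StrictMono (sched ℓ t)
  /-- vehicle capacity on a line -/
  cap : L → ℕ
  /-- number of passengers of a request in a scenario -/
  D : P → S → ℕ
  /-- maximal number of checkpoints that may be skipped in a row -/
  K : ℕ
  /-- distance from a station to the stretch of a line between two of its checkpoints -/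
  lineDist : ∀ ℓ, Fin (nCP ℓ) → Fin (nCP ℓ) → N → ℝ
  /-- maximal deviation from the reference line -/
  maxDev : ℝ
  /-- requested drop-off times -/
  tReq : P → ℝ
  /-- tolerance around the requested drop-off times -/
  tol : ℝ
  /-- walking, waiting and in-vehicle time of a passenger who is picked up on a segment -/
  walk : ∀ ℓ, Dep ℓ → S → Seg N P → P → ℝ
  wait : ∀ ℓ, Dep ℓ → S → Seg N P → P → ℝ
  travel : ∀ ℓ, Dep ℓ → S → Seg N P → P → ℝ
  /-- limit on walking -/
  maxWalk : ℝ
  /-- limit on waiting -/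
  maxWait : ℝ
  /-- direct travel time of a passenger -/
  dir : P → ℝ
  dir_pos : ∀ p, 0 < dir p
  /-- delay and earliness of a passenger at the destination -/
  late : ∀ ℓ, Dep ℓ → P → ℝ
  early : ∀ ℓ, Dep ℓ → P → ℝ
  /-- weights of walking, waiting, detour and displacement, and reward per pickup -/
  lam : ℝ
  mu : ℝ
  sigma : ℝ
  delta : ℝ
  M : ℝ

namespace MiND

variable {N P S L : Type*} {Dep : L → Type*}

/-! ### Reference trips -/

/-- A reference trip: a line and one of its departure periods. -/
abbrev Trip (_I : MiND N P S L Dep) := Σ ℓ : L, Dep ℓ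

variable (I : MiND N P S L Dep) (tr : I.Trip) (s : S)

/-- Positions of the checkpoints along the line of a trip. -/
abbrev CP := Fin (I.nCP tr.1)

/-- The first checkpoint. -/
def first : I.CP tr := ⟨0, lt_of_lt_of_le Nat.two_pos (I.two_le_nCP tr.1)⟩

/-- The final checkpoint. -/
def last : I.CP tr :=
  ⟨I.nCP tr.1 - 1, Nat.sub_lt (lt_of_lt_of_le Nat.two_pos (I.two_le_nCP tr.1)) Nat.one_pos⟩

/-- The station of a checkpoint. -/
abbrev station (i : I.CP tr) : N := I.cp tr.1 i

/-- Scheduled time at a checkpoint. -/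
abbrev T (i : I.CP tr) : ℝ := I.sched tr.1 tr.2 i

/-- Ordered checkpoint pairs with at most `K` checkpoints skipped in between. -/
def Gam : Set (I.CP tr × I.CP tr) := {g | g.1 < g.2 ∧ (g.2 : ℕ) - (g.1 : ℕ) ≤ I.K + 1}

/-- Stations that can be visited between two checkpoints. -/
def between (i j : I.CP tr) : Set N := {k | I.lineDist tr.1 i j k ≤ I.maxDev}

/-- The trip can serve the request within the tolerance on the drop-off time. -/
def Compatible (p : P) : Prop := |I.T tr (I.last tr) - I.tReq p| ≤ I.tol

/-- The load-augmented segments available to a trip: the road exists, and every passenger picked up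
is compatible with the trip and is offered acceptable walking and waiting times. -/
def segments : Set (Seg N P) :=
  {e | e.road ∈ I.roads ∧ ∀ p ∈ e.pax, I.Compatible tr p ∧
    I.walk tr.1 tr.2 s e p ≤ I.maxWalk ∧
    0 ≤ I.wait tr.1 tr.2 s e p ∧ I.wait tr.1 tr.2 s e p ≤ I.maxWait}

/-- Number of passengers in a set of requests. -/
def loadOf (A : Finset P) : ℕ := ∑ p ∈ A, I.D p s

/-- Cost of serving the request `p` `c` times with total walking, waiting and in-vehicle times
`w`, `a` and `b`. For `c = 1` this is the level-of-service cost of one pickup. -/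
def serviceCost (p : P) (c w a b : ℝ) : ℝ :=
  I.D p s * (I.lam * w + I.mu * a + I.sigma * (b / I.dir p)
    + c * (I.delta * (I.late tr.1 tr.2 p / I.dir p)
      + I.delta / 2 * (I.early tr.1 tr.2 p / I.dir p) - I.M))

/-! ### Subpaths -/

/-- A subpath: a sequence of load-augmented segments from the checkpoint `src` to the checkpoint
`dst`, with at most `K` checkpoints skipped, within the allowed deviation, respecting the vehicle
capacity and the time between the two scheduled times, and picking up every passenger request at
most once. -/
structure Subpath where
  src : I.CP tr
  dst : I.CP tr
  segs : List (Seg N P)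
  pair_mem : (src, dst) ∈ I.Gam tr
  walk : IsWalk (I.station tr src) (I.station tr dst) segs
  segs_mem : ∀ e ∈ segs, e ∈ I.segments tr s
  dev : ∀ e ∈ segs, e.road.1 ∈ I.between tr src dst ∧ e.road.2 ∈ I.between tr src dst
  disj : segs.Pairwise fun e f => Disjoint e.pax f.pax
  load_le : (segs.map fun e => I.loadOf s e.pax).sum ≤ I.cap tr.1
  time_le : (segs.map fun e => I.tt e.road).sum ≤ I.T tr dst - I.T tr src

variable {I tr s}

/-- Travel time of a subpath. -/
def Subpath.time (r : I.Subpath tr s) : ℝ := (r.segs.map fun e => I.tt e.road).sum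

/-- Passenger requests served by a subpath. -/
def Subpath.pax (r : I.Subpath tr s) : Finset P := r.segs.foldr (fun e A => e.pax ∪ A) ∅

/-- Number of passengers picked up by a subpath. -/
def Subpath.load (r : I.Subpath tr s) : ℕ := I.loadOf s r.pax

/-- The sum of `f e` over the segments `e` of a list on which `p` is picked up. -/
def pickupSum (w : List (Seg N P)) (p : P) (f : Seg N P → ℝ) : ℝ :=
  (w.map fun e => if p ∈ e.pax then f e else 0).sum

/-- Walking time of a passenger on a subpath: the one of the segment of the pickup. -/
def Subpath.walkTime (r : I.Subpath tr s) (p : P) : ℝ :=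
  pickupSum r.segs p fun e => I.walk tr.1 tr.2 s e p

/-- Waiting time of a passenger on a subpath: the one of the segment of the pickup. -/
def Subpath.waitTime (r : I.Subpath tr s) (p : P) : ℝ :=
  pickupSum r.segs p fun e => I.wait tr.1 tr.2 s e p

/-- In-vehicle time of a passenger on a subpath: the one of the segment of the pickup. -/
def Subpath.travelTime (r : I.Subpath tr s) (p : P) : ℝ :=
  pickupSum r.segs p fun e => I.travel tr.1 tr.2 s e p

/-- Cost of a subpath. -/
def Subpath.cost (r : I.Subpath tr s) : ℝ :=
  ∑ p ∈ r.pax, I.serviceCost tr s p 1 (r.walkTime p) (r.waitTime p) (r.travelTime p)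

lemma length_mul_le_sum {α : Type*} (f : α → ℝ) (m : ℝ) (w : List α) (h : ∀ e ∈ w, m ≤ f e) :
    (w.length : ℝ) * m ≤ (w.map f).sum := by
  induction w with
  | nil => simp
  | cons e w ih =>
    have h1 := h e (by simp)
    have h2 := ih fun a ha => h a (by simp [ha])
    simp only [List.length_cons, List.map_cons, List.sum_cons]
    push_cast
    linarith

instance [Finite N] [Finite P] : Finite (I.Subpath tr s) := by
  obtain ⟨m, hm, hle⟩ : ∃ m : ℝ, 0 < m ∧ ∀ e ∈ I.roads, m ≤ I.tt e := by
    rcases I.roads.eq_empty_or_nonempty with h | h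
    · exact ⟨1, one_pos, by simp [h]⟩
    · obtain ⟨e, he, hmin⟩ := I.roads.exists_min_image I.tt h
      exact ⟨I.tt e, I.tt_pos e he, hmin⟩
  obtain ⟨B, hB⟩ : ∃ B : ℕ, ∀ r : I.Subpath tr s, r.segs.length ≤ B := by
    obtain ⟨B, hB⟩ := exists_nat_ge (I.T tr (I.last tr) / m)
    refine ⟨B, fun r => ?_⟩
    have h1 := length_mul_le_sum (fun e : Seg N P => I.tt e.road) m r.segs
      fun e he => hle _ (r.segs_mem e he).1
    have h2 : I.T tr r.dst ≤ I.T tr (I.last tr) :=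
      (I.sched_strictMono tr.1 tr.2).monotone (by
        rw [Fin.le_def]; simp only [last]; have := r.dst.isLt; omega)
    have h3 : 0 ≤ I.T tr r.src := I.sched_nonneg _ _ _
    have h4 := r.time_le
    have h5 : (r.segs.length : ℝ) ≤ I.T tr (I.last tr) / m := by
      rw [le_div_iff₀ hm]; linarith
    exact_mod_cast h5.trans hB
  have hf := List.finite_length_le (Seg N P) B
  have : Finite {w : List (Seg N P) // w.length ≤ B} := hf
  refine Finite.of_injective (β := I.CP tr × I.CP tr × {w : List (Seg N P) // w.length ≤ B})
    (fun r => (r.src, r.dst, ⟨r.segs, hB r⟩)) ?_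
  rintro ⟨_, _, _⟩ ⟨_, _, _⟩ h
  simp only [Prod.mk.injEq, Subtype.mk.injEq] at h
  obtain ⟨rfl, rfl, rfl⟩ := h
  rfl

instance [Finite N] [Finite P] : Fintype (I.Subpath tr s) := Fintype.ofFinite _

/-! ### Paths -/

/-- `Chained i j l`: the subpaths of the list `l` follow each other from checkpoint `i` to
checkpoint `j`. -/
def Chained : I.CP tr → I.CP tr → List (I.Subpath tr s) → Prop
  | i, j, [] => i = j
  | i, j, r :: l => r.src = i ∧ Chained r.dst j l

variable (I tr s)

/-- A full path of a trip: a sequence of segments from the first to the final checkpoint, cut into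
legs at the checkpoints that it visits on schedule, which picks up at most as many passengers as the
vehicle can hold. -/
structure Path where
  legs : List (I.Subpath tr s)
  chained : Chained (I.first tr) (I.last tr) legs
  load_le : (legs.map Subpath.load).sum ≤ I.cap tr.1

variable {I tr s}

/-- All segments of a path, in order. -/
def Path.segs (q : I.Path tr s) : List (Seg N P) := q.legs.flatMap Subpath.segs

/-- Number of times that the path picks up the request `p`. (It is `0` or `1` if the path serves
every request at most once.) -/
def Path.count (q : I.Path tr s) (p : P) : ℝ := pickupSum q.segs p fun _ => 1

/-- Cost of a path, summed over all its pickups. -/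
def Path.cost [Fintype P] (q : I.Path tr s) : ℝ :=
  ∑ p : P, I.serviceCost tr s p (q.count p)
    (pickupSum q.segs p fun e => I.walk tr.1 tr.2 s e p)
    (pickupSum q.segs p fun e => I.wait tr.1 tr.2 s e p)
    (pickupSum q.segs p fun e => I.travel tr.1 tr.2 s e p)

lemma Chained.length_le (l : List (I.Subpath tr s)) (i j : I.CP tr) (h : Chained i j l) :
    (i : ℕ) + l.length ≤ j := by
  induction l generalizing i with
  | nil => simp only [Chained] at h; simp [h]
  | cons r l ih =>
    obtain ⟨rfl, h⟩ := h
    have h1 := ih _ h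
    have h2 : (r.src : ℕ) < r.dst := r.pair_mem.1
    simp only [List.length_cons]
    omega

instance [Finite N] [Finite P] : Finite (I.Path tr s) := by
  have hf := List.finite_length_le (I.Subpath tr s) (I.nCP tr.1)
  have : Finite {w : List (I.Subpath tr s) // w.length ≤ I.nCP tr.1} := hf
  refine Finite.of_injective
    (β := {w : List (I.Subpath tr s) // w.length ≤ I.nCP tr.1})
    (fun q => ⟨q.legs, by
      have h1 := Chained.length_le _ _ _ q.chained
      have h2 := (I.last tr).isLt
      omega⟩) ?_
  rintro ⟨_, _, _⟩ ⟨_, _, _⟩ h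
  simp only [Subtype.mk.injEq] at h
  subst h
  rfl

instance [Finite N] [Finite P] : Fintype (I.Path tr s) := Fintype.ofFinite _

/-! ### Flow balance -/

/-- Outgoing minus incoming flow at the node `n` of a network with arc set `A`. -/
def netOut {A V : Type*} [Fintype A] (tail head : A → V) (y : A → ℝ) (n : V) : ℝ :=
  (∑ a with tail a = n, y a) - ∑ a with head a = n, y a

/-! ### Path-based formulation -/

variable (I s)

/-- Objective values of the feasible solutions of the path-based formulation, for given first-stage
decisions `x` and `z`, when every variable is restricted to `dom`. -/
def pathValues [Fintype N] [Fintype P] [Fintype L] [∀ ℓ, Fintype (Dep ℓ)]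
    (dom : Set ℝ) (x : I.Trip → ℝ) (z : I.Trip → P → ℝ) : Set ℝ :=
  {v | ∃ ζ : ∀ tr : I.Trip, I.Path tr s → ℝ,
    (∀ tr q, ζ tr q ∈ dom) ∧
    (∀ tr, ∑ q, ζ tr q = x tr) ∧
    (∀ tr p, I.Compatible tr p → ∑ q, q.count p * ζ tr q ≤ z tr p) ∧
    v = ∑ tr, ∑ q, q.cost * ζ tr q}

/-! ### Subpath-based formulation -/

variable (tr)

/-- Nodes of the load-expanded network other than the sink: a checkpoint and a load. -/
abbrev LNode := I.CP tr × Fin (I.cap tr.1 + 1)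

/-- Traveling arcs of the load-expanded network. -/
abbrev LTravel := {a : I.Subpath tr s × I.LNode tr × I.LNode tr //
  a.2.1.1 = a.1.src ∧ a.2.2.1 = a.1.dst ∧ (a.2.2.2 : ℕ) = a.2.1.2 + a.1.load}

/-- Terminating arcs of the load-expanded network, given by their tails. -/
abbrev LTerm := {n : I.LNode tr // n.1 = I.last tr}

/-- Arcs of the load-expanded network. -/
abbrev LArc := I.LTravel tr s ⊕ I.LTerm tr

variable {I tr s}

/-- Tail of an arc; the sink is `none`. -/
def LArc.tail : I.LArc tr s → Option (I.LNode tr)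
  | .inl a => some a.1.2.1
  | .inr n => some n.1

/-- Head of an arc; the sink is `none`. -/
def LArc.head : I.LArc tr s → Option (I.LNode tr)
  | .inl a => some a.1.2.2
  | .inr _ => none

/-- Passenger requests served on an arc. -/
def LArc.pax : I.LArc tr s → Finset P
  | .inl a => a.1.1.pax
  | .inr _ => ∅

/-- Cost of an arc. -/
def LArc.cost : I.LArc tr s → ℝ
  | .inl a => a.1.1.cost
  | .inr _ => 0

variable (I s)

/-- Objective values of the feasible solutions of the subpath-based formulation, for given
first-stage decisions `x` and `z`, when every variable is restricted to `dom`. -/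
def subpathValues [Fintype N] [Fintype P] [Fintype L] [∀ ℓ, Fintype (Dep ℓ)]
    (dom : Set ℝ) (x : I.Trip → ℝ) (z : I.Trip → P → ℝ) : Set ℝ :=
  {v | ∃ y : ∀ tr : I.Trip, I.LArc tr s → ℝ,
    (∀ tr a, y tr a ∈ dom) ∧
    (∀ tr n, netOut LArc.tail LArc.head (y tr) n =
      if n = some (I.first tr, 0) then x tr else if n = none then - x tr else 0) ∧
    (∀ tr p, I.Compatible tr p → ∑ a : I.LArc tr s with p ∈ a.pax, y tr a ≤ z tr p) ∧
    v = ∑ tr, ∑ a, LArc.cost a * y tr a}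

/-! ### Segment-based formulation -/

variable (ρ : ℝ)

/-- Number of time steps of length `ρ` from the time origin to the arrival of the last trip. -/
def horizon [Fintype L] [∀ ℓ, Fintype (Dep ℓ)] : ℕ :=
  Finset.univ.sup fun tr : I.Trip => ⌈I.T tr (I.last tr) / ρ⌉₊

/-- Every scheduled time is a multiple of `ρ`. -/
def OnGrid : Prop := ∀ (tr : I.Trip) (i : I.CP tr), ∃ n : ℕ, I.T tr i = n * ρ

variable (tr)
variable [Fintype L] [∀ ℓ, Fintype (Dep ℓ)]

/-- Nodes of the time-load-expanded network other than the sink: a station, a load, and a time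
counted in steps of length `ρ`. -/
abbrev TNode := N × Fin (I.cap tr.1 + 1) × Fin (I.horizon ρ + 1)

/-- Traveling arcs of the time-load-expanded network. Travel times are rounded up to the next
multiple of the time step. -/
abbrev TTravel := {a : Seg N P × I.TNode tr ρ × I.TNode tr ρ //
  a.1 ∈ I.segments tr s ∧ (a.2.1.1, a.2.2.1) = a.1.road ∧
  (a.2.2.2.1 : ℕ) = a.2.1.2.1 + I.loadOf s a.1.pax ∧
  (a.2.2.2.2 : ℕ) = a.2.1.2.2 + ⌈I.tt a.1.road / ρ⌉₊}

/-- Idling arcs of the time-load-expanded network. -/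
abbrev TIdle := {a : I.TNode tr ρ × I.TNode tr ρ //
  a.1.1 = a.2.1 ∧ a.1.2.1 = a.2.2.1 ∧ (a.2.2.2 : ℕ) = a.1.2.2 + 1}

/-- Terminating arcs of the time-load-expanded network, given by their tails. -/
abbrev TTerm := {n : I.TNode tr ρ // n.1 = I.station tr (I.last tr)}

/-- Arcs of the time-load-expanded network. -/
abbrev TArc := I.TTravel tr s ρ ⊕ I.TIdle tr ρ ⊕ I.TTerm tr ρ

variable {I tr s ρ}

/-- The real time of a node. -/
def TNode.time (n : I.TNode tr ρ) : ℝ := (n.2.2 : ℕ) * ρ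

/-- The node is at checkpoint `i` at its scheduled time. -/
def TNode.AtCP (n : I.TNode tr ρ) (i : I.CP tr) : Prop :=
  n.1 = I.station tr i ∧ TNode.time n = I.T tr i

/-- The node is the source: the first checkpoint at its scheduled time, with an empty vehicle. -/
def TNode.IsSource (n : I.TNode tr ρ) : Prop := TNode.AtCP n (I.first tr) ∧ n.2.1 = 0

/-- The node lies in the space-time region of the checkpoint pair `(i, j)`. -/
def TNode.InRegion (n : I.TNode tr ρ) (i j : I.CP tr) : Prop :=
  n.1 ∈ I.between tr i j ∧ TNode.time n ∈ Set.Icc (I.T tr i) (I.T tr j)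

/-- Tail of an arc; the sink is `none`. -/
def TArc.tail : I.TArc tr s ρ → Option (I.TNode tr ρ)
  | .inl a => some a.1.2.1
  | .inr (.inl a) => some a.1.1
  | .inr (.inr n) => some n.1

/-- Head of an arc; the sink is `none`. -/
def TArc.head : I.TArc tr s ρ → Option (I.TNode tr ρ)
  | .inl a => some a.1.2.2
  | .inr (.inl a) => some a.1.2
  | .inr (.inr _) => none

/-- Passenger requests served on an arc. -/
def TArc.pax : I.TArc tr s ρ → Finset P
  | .inl a => a.1.1.pax
  | .inr _ => ∅

/-- Cost of an arc. -/
def TArc.cost : I.TArc tr s ρ → ℝ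
  | .inl a => ∑ p ∈ a.1.1.pax, I.serviceCost tr s p 1 (I.walk tr.1 tr.2 s a.1.1 p)
      (I.wait tr.1 tr.2 s a.1.1 p) (I.travel tr.1 tr.2 s a.1.1 p)
  | .inr _ => 0

variable (I s ρ)

/-- Objective values of the feasible solutions of the segment-based formulation with time step `ρ`,
for given first-stage decisions `x` and `z`, when every variable is restricted to `dom`. The
constraints are, in order: flow balance in the time-load-expanded network, passenger assignment,
flow balance between checkpoints, visits of the selected checkpoints on schedule, and restriction of
traveling and idling to the regions of the selected checkpoint pairs. -/
def segmentValues [Fintype N] [Fintype P]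
    (dom : Set ℝ) (x : I.Trip → ℝ) (z : I.Trip → P → ℝ) : Set ℝ :=
  {v | ∃ (ξ : ∀ tr : I.Trip, I.TArc tr s ρ → ℝ) (β : ∀ tr : I.Trip, I.Gam tr → ℝ),
    (∀ tr a, ξ tr a ∈ dom) ∧ (∀ tr g, β tr g ∈ dom) ∧
    (∀ tr n, netOut TArc.tail TArc.head (ξ tr) n =
      if ∃ m, n = some m ∧ TNode.IsSource m then x tr else if n = none then - x tr else 0) ∧
    (∀ tr p, I.Compatible tr p → ∑ a : I.TArc tr s ρ with p ∈ a.pax, ξ tr a ≤ z tr p) ∧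
    (∀ tr i, netOut (fun g : I.Gam tr => g.1.1) (fun g : I.Gam tr => g.1.2) (β tr) i =
      if i = I.first tr then x tr else if i = I.last tr then - x tr else 0) ∧
    (∀ tr i, i ≠ I.first tr →
      ∑ g : I.Gam tr with g.1.2 = i, β tr g ≤
        ∑ a : I.TArc tr s ρ with ∃ m, a.head = some m ∧ TNode.AtCP m i, ξ tr a) ∧
    (∀ tr (a : I.TArc tr s ρ) n m, a.tail = some n → a.head = some m →
      ξ tr a ≤ ∑ g : I.Gam tr with
        TNode.InRegion n g.1.1 g.1.2 ∧ TNode.InRegion m g.1.1 g.1.2, β tr g) ∧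
    v = ∑ tr, ∑ a, TArc.cost a * ξ tr a}

end MiND

end

/-! All three statements rest on flow decomposition. In each network some rank (checkpoint position
or time index) increases along every arc, so a nonnegative flow of value `x` is a positive
combination of walks from source to sink (`exists_walk_decomposition`). The coefficients stay in any
additive subgroup `G` of `ℝ` that contains `x` and the arc flows. Binary variables are those in
`[0,1] ∩ ℤ`, so one argument with `G = ℤ` or `G = ⊤` covers integer programs and relaxations alike.

Walks to the sink of the load-expanded network are exactly the chains of subpaths that respect the
capacity, that is, the paths (`Chained.exists_arcWalk`, `LArc.chained_of_arcWalk`). Costs and pickup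
counts are additive along them, so combinations of paths and flows carry the same objective and the
same assignment constraints.

For the segment-based formulation, there are finitely many subpaths, all with strict slack, and
rounding loses at most one time step per segment. A fine enough step therefore keeps every subpath
on schedule (`exists_timeStep`). A subpath then becomes a run of traveling arcs followed by idling
until the scheduled time, and any combination of paths yields both `ξ` and `β` (`exists_time_flow`).

Conversely, for binary data and `x = 1`, `ξ` and `β` are one walk each. The visit constraints make
the walk of `ξ` meet the checkpoints of `β` on schedule, the region constraints confine it in
between, and cutting it at these visits recovers the subpaths (`exists_legs`). Fractional `ξ` and
`β` decompose separately, with nothing that pairs their walks, so this direction is for integer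
solutions. -/

noncomputable section

open scoped Classical

/-! ### Walks and flows in finite acyclic networks -/

section Network

variable {A V : Type*}

/-- The list of arcs `l` is a walk from the node `u` to the node `v`. -/
def IsArcWalk (tail head : A → V) : V → V → List A → Prop
  | u, v, [] => u = v
  | u, v, a :: l => tail a = u ∧ IsArcWalk tail head (head a) v l

/-- Multiplicity of an arc in a list of arcs. -/
def mult (l : List A) (a : A) : ℝ := (l.map fun b => if b = a then (1 : ℝ) else 0).sum

lemma sum_map_ite_nonneg (l : List A) (Q : A → Prop) [DecidablePred Q] :
    0 ≤ (l.map fun a => if Q a then (1 : ℝ) else 0).sum := by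
  refine List.sum_nonneg ?_
  simp only [List.mem_map]
  rintro _ ⟨b, -, rfl⟩
  split_ifs <;> norm_num

lemma mult_nonneg (l : List A) (a : A) : 0 ≤ mult l a :=
  sum_map_ite_nonneg l _

lemma mult_cons (b : A) (l : List A) (a : A) :
    mult (b :: l) a = (if b = a then (1 : ℝ) else 0) + mult l a := by
  simp [mult]

lemma mult_of_notMem {l : List A} {a : A} (h : a ∉ l) : mult l a = 0 := by
  induction l with
  | nil => simp [mult]
  | cons b l ih =>
    simp only [List.mem_cons, not_or] at h
    rw [mult_cons, ih h.2, if_neg (Ne.symm h.1), add_zero]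

lemma one_le_mult {l : List A} {a : A} (h : a ∈ l) : 1 ≤ mult l a := by
  induction l with
  | nil => simp at h
  | cons b l ih =>
    rw [mult_cons]
    rcases List.mem_cons.1 h with rfl | h
    · simpa using mult_nonneg l a
    · have := ih h
      split_ifs <;> linarith

lemma mult_le_one {l : List A} (h : l.Nodup) (a : A) : mult l a ≤ 1 := by
  induction l with
  | nil => simp [mult]
  | cons b l ih =>
    rw [List.nodup_cons] at h
    rw [mult_cons]
    split_ifs with hb
    · subst hb; rw [mult_of_notMem h.1]; norm_num
    · simpa using ih h.2

lemma mul_mult_mem {G : AddSubgroup ℝ} {c : ℝ} (hc : c ∈ G) (l : List A) (a : A) :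
    c * mult l a ∈ G := by
  induction l with
  | nil => simp [mult]
  | cons b l ih =>
    rw [mult_cons, mul_add]
    refine G.add_mem ?_ ih
    split_ifs <;> simp [hc]

lemma sum_mul_mult [Fintype A] (l : List A) (f : A → ℝ) :
    ∑ a, f a * mult l a = (l.map f).sum := by
  induction l with
  | nil => simp [mult]
  | cons b l ih => simp [mult_cons, mul_add, Finset.sum_add_distrib, ih]

lemma sum_filter_mult [Fintype A] (l : List A) (Q : A → Prop) [DecidablePred Q] :
    ∑ a with Q a, mult l a = (l.map fun a => if Q a then (1 : ℝ) else 0).sum := by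
  rw [← sum_mul_mult, Finset.sum_filter]
  refine Finset.sum_congr rfl fun a _ => ?_
  split_ifs <;> simp

lemma sum_map_ite_head {V : Type*} (l : List A) (head : A → V) (v : V)
    [DecidablePred fun a => head a = v] :
    (l.map fun a => if head a = v then (1 : ℝ) else 0).sum = mult (l.map head) v := by
  simp only [mult, List.map_map, Function.comp_def]
  congr!

lemma one_le_sum_map_ite {l : List A} {Q : A → Prop} [DecidablePred Q] {a : A} (ha : a ∈ l)
    (hQ : Q a) : 1 ≤ (l.map fun a => if Q a then (1 : ℝ) else 0).sum := by
  obtain ⟨l₁, l₂, rfl⟩ := List.append_of_mem ha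
  rw [List.map_append, List.map_cons, List.sum_append, List.sum_cons, if_pos hQ]
  linarith [sum_map_ite_nonneg l₁ Q, sum_map_ite_nonneg l₂ Q]

variable {tail head : A → V}

lemma IsArcWalk.append {u v w : V} {l k : List A} (h : IsArcWalk tail head u v l)
    (h' : IsArcWalk tail head v w k) : IsArcWalk tail head u w (l ++ k) := by
  induction l generalizing u with
  | nil => cases h; exact h'
  | cons a l ih => exact ⟨h.1, ih h.2⟩

/-- A walk can be cut behind each of its arcs. -/
lemma IsArcWalk.split {u v : V} {l : List A} (h : IsArcWalk tail head u v l) {a : A}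
    (ha : a ∈ l) : ∃ l₁ l₂, l = l₁ ++ l₂ ∧ IsArcWalk tail head u (head a) l₁ ∧
      IsArcWalk tail head (head a) v l₂ := by
  induction l generalizing u with
  | nil => simp at ha
  | cons b l ih =>
    rcases List.mem_cons.1 ha with rfl | hal
    · exact ⟨[a], l, rfl, ⟨h.1, rfl⟩, h.2⟩
    · obtain ⟨l₁, l₂, rfl, h₁, h₂⟩ := ih h.2 hal
      exact ⟨b :: l₁, l₂, rfl, ⟨h.1, h₁⟩, h₂⟩

/-- A nontrivial walk has a last arc. This supplies the arrivals counted by the visit constraints.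
-/
lemma IsArcWalk.exists_head_eq {u v : V} {l : List A} (h : IsArcWalk tail head u v l)
    (hne : u ≠ v) : ∃ a ∈ l, head a = v := by
  induction l generalizing u with
  | nil => exact absurd h hne
  | cons a l ih =>
    by_cases ha : head a = v
    · exact ⟨a, by simp, ha⟩
    · obtain ⟨b, hb, hv⟩ := ih h.2 ha
      exact ⟨b, by simp [hb], hv⟩

section Rank

-- Acyclicity is used in the form of a rank that increases along every arc.
variable {rk : V → ℕ} (hr : ∀ a, rk (tail a) < rk (head a))
include hr

lemma IsArcWalk.rank_le {u v : V} {l : List A} (h : IsArcWalk tail head u v l) :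
    rk u ≤ rk v := by
  induction l generalizing u with
  | nil => cases h; exact le_rfl
  | cons b l ih => have := ih h.2; have := hr b; rw [h.1] at this; omega

lemma IsArcWalk.rank_mem {u v : V} {l : List A} (h : IsArcWalk tail head u v l) {a : A}
    (ha : a ∈ l) : rk u ≤ rk (tail a) ∧ rk (head a) ≤ rk v := by
  induction l generalizing u with
  | nil => simp at ha
  | cons b l ih =>
    have h1 := hr b
    rcases List.mem_cons.1 ha with rfl | hal
    · exact ⟨by rw [h.1], h.2.rank_le hr⟩
    · have := ih h.2 hal
      rw [h.1] at h1
      exact ⟨by omega, this.2⟩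

/-- The ranks of the heads increase strictly, so no node is entered twice. -/
lemma IsArcWalk.nodup_heads {u v : V} {l : List A} (h : IsArcWalk tail head u v l) :
    (l.map head).Nodup := by
  induction l generalizing u with
  | nil => simp
  | cons b l ih =>
    rw [List.map_cons, List.nodup_cons]
    refine ⟨fun hb => ?_, ih h.2⟩
    obtain ⟨a, ha, hab⟩ := List.mem_map.1 hb
    have h1 := (h.2.rank_mem hr ha).1
    have h2 := hr a
    rw [hab] at h2
    omega

lemma IsArcWalk.nodup {u v : V} {l : List A} (h : IsArcWalk tail head u v l) : l.Nodup :=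
  (h.nodup_heads hr).of_map _

end Rank

variable [Fintype A]

/-- Displays the net outflow as a linear functional of `y`, to which `sum_mul_mult` applies. -/
lemma netOut_eq_sum (y : A → ℝ) (n : V) : MiND.netOut tail head y n =
    ∑ a, ((if tail a = n then (1 : ℝ) else 0) - if head a = n then 1 else 0) * y a := by
  simp only [MiND.netOut, Finset.sum_filter, sub_mul, Finset.sum_sub_distrib, ite_mul, one_mul,
    zero_mul]

lemma IsArcWalk.netOut_mult {u v : V} {l : List A} (h : IsArcWalk tail head u v l) (n : V) :
    MiND.netOut tail head (mult l) n = (if n = u then 1 else 0) - if n = v then 1 else 0 := by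
  rw [netOut_eq_sum, sum_mul_mult]
  induction l generalizing u with
  | nil => cases h; simp
  | cons b l ih =>
    rw [List.map_cons, List.sum_cons, ih h.2, h.1]
    simp only [@eq_comm _ n]
    ring

lemma netOut_sub_mul (y z : A → ℝ) (c : ℝ) (n : V) :
    MiND.netOut tail head (fun a => y a - c * z a) n =
      MiND.netOut tail head y n - c * MiND.netOut tail head z n := by
  simp only [netOut_eq_sum, Finset.mul_sum, ← Finset.sum_sub_distrib]
  exact Finset.sum_congr rfl fun a _ => by ring

/-- A nonnegative combination of walks from `src` to `snk` is a flow. -/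
lemma netOut_sum_mult {ι : Type*} [Fintype ι] (c : ι → ℝ) (w : ι → List A) {src snk : V}
    (hw : ∀ i, IsArcWalk tail head src snk (w i)) (n : V) :
    MiND.netOut tail head (fun a => ∑ i, c i * mult (w i) a) n =
      (if n = src then ∑ i, c i else 0) - if n = snk then ∑ i, c i else 0 := by
  have : MiND.netOut tail head (fun a => ∑ i, c i * mult (w i) a) n =
      ∑ i, c i * MiND.netOut tail head (mult (w i)) n := by
    simp only [netOut_eq_sum, Finset.mul_sum]
    rw [Finset.sum_comm]
    exact Finset.sum_congr rfl fun i _ => Finset.sum_congr rfl fun a _ => by ring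
  rw [this]
  simp only [(hw _).netOut_mult, ← Finset.sum_mul]
  split_ifs <;> simp

lemma sum_mul_sum_mult {ι : Type*} [Fintype ι] (c : ι → ℝ) (w : ι → List A) (f : A → ℝ) :
    ∑ a, f a * ∑ i, c i * mult (w i) a = ∑ i, c i * ((w i).map f).sum := by
  simp only [← sum_mul_mult, Finset.mul_sum]
  rw [Finset.sum_comm]
  exact Finset.sum_congr rfl fun i _ => Finset.sum_congr rfl fun a _ => by ring

lemma sum_filter_sum_mult {ι : Type*} [Fintype ι] (c : ι → ℝ) (w : ι → List A) (Q : A → Prop)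
    [DecidablePred Q] : ∑ a with Q a, ∑ i, c i * mult (w i) a =
      ∑ i, c i * ((w i).map fun a => if Q a then (1 : ℝ) else 0).sum := by
  rw [← sum_mul_sum_mult, Finset.sum_filter]
  exact Finset.sum_congr rfl fun a _ => by split_ifs <;> simp

section Decomposition

variable {rk : V → ℕ} (hr : ∀ a, rk (tail a) < rk (head a))

/-- Flow that enters or originates at a node which absorbs none must leave it again. -/
lemma exists_pos_out {y : A → ℝ} (hy : ∀ a, 0 ≤ y a) {v : V}
    (h0 : 0 ≤ MiND.netOut tail head y v)
    (h : 0 < MiND.netOut tail head y v ∨ ∃ a, head a = v ∧ 0 < y a) :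
    ∃ a, tail a = v ∧ 0 < y a := by
  by_contra! hc
  have h1 : ∑ a with tail a = v, y a = 0 :=
    Finset.sum_eq_zero fun a ha => le_antisymm (hc a (Finset.mem_filter.1 ha).2) (hy a)
  unfold MiND.netOut at h0 h
  rw [h1] at h0 h
  have h2 : 0 ≤ ∑ a with head a = v, y a := Finset.sum_nonneg fun a _ => hy a
  rcases h with h | ⟨a, ha, hya⟩
  · linarith
  · have hmem : a ∈ Finset.univ.filter fun a => head a = v := by simp [ha]
    have := Finset.single_le_sum (f := y) (fun a _ => hy a) hmem
    linarith

include hr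

/-- Arcs with positive flow are followed until the sink is reached. The number `k` bounds the
remaining steps: each one raises the rank, which cannot exceed the largest rank of a head. -/
lemma exists_pos_walk {y : A → ℝ} (hy : ∀ a, 0 ≤ y a) {snk : V}
    (h0 : ∀ v, v ≠ snk → 0 ≤ MiND.netOut tail head y v) (k : ℕ) (v : V)
    (hk : (Finset.univ.sup fun a => rk (head a)) < rk v + k)
    (h : v = snk ∨ 0 < MiND.netOut tail head y v ∨ ∃ a, head a = v ∧ 0 < y a) :
    ∃ l, IsArcWalk tail head v snk l ∧ ∀ a ∈ l, 0 < y a := by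
  induction k generalizing v with
  | zero =>
    by_cases hv : v = snk
    · exact ⟨[], hv, by simp⟩
    · obtain ⟨a, rfl, -⟩ := exists_pos_out hy (h0 v hv) (h.resolve_left hv)
      have h1 := Finset.le_sup (f := fun a => rk (head a)) (Finset.mem_univ a)
      have h2 := hr a
      omega
  | succ k ih =>
    by_cases hv : v = snk
    · exact ⟨[], hv, by simp⟩
    · obtain ⟨a, rfl, ha⟩ := exists_pos_out hy (h0 v hv) (h.resolve_left hv)
      have h2 := hr a
      obtain ⟨l, hl, hpos⟩ := ih (head a) (by omega) (Or.inr (Or.inr ⟨a, rfl, ha⟩))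
      exact ⟨a :: l, ⟨rfl, hl⟩, by simpa using ⟨ha, hpos⟩⟩

/-- Among the arcs with positive flow, take one whose head has maximal rank. By conservation the
flow continues from there on an arc whose head ranks higher. -/
lemma eq_zero_of_netOut_eq_zero {y : A → ℝ} (hy : ∀ a, 0 ≤ y a)
    (h0 : ∀ v, MiND.netOut tail head y v = 0) (a : A) : y a = 0 := by
  by_contra ha
  have hne : (Finset.univ.filter fun a => 0 < y a).Nonempty :=
    ⟨a, by simpa using lt_of_le_of_ne (hy a) (Ne.symm ha)⟩
  obtain ⟨b, hb, hmax⟩ := Finset.exists_max_image _ (fun a => rk (head a)) hne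
  simp only [Finset.mem_filter, Finset.mem_univ, true_and] at hb hmax
  obtain ⟨c, hc, hyc⟩ := exists_pos_out hy (h0 (head b)).ge (Or.inr ⟨b, rfl, hb⟩)
  have h1 := hmax c hyc
  have h2 := hr c
  rw [hc] at h2
  omega

/-- Flow decomposition: a nonnegative flow in a finite acyclic network is a positive combination of
walks from the source to the sink, with coefficients in every additive group that contains the
value and the entries of the flow. -/
theorem exists_walk_decomposition (G : AddSubgroup ℝ) {src snk : V} (hne : src ≠ snk) (y : A → ℝ)
    (x : ℝ) (hx : 0 ≤ x) (hxG : x ∈ G) (hy : ∀ a, 0 ≤ y a) (hyG : ∀ a, y a ∈ G)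
    (h : ∀ n, MiND.netOut tail head y n = (if n = src then x else 0) - if n = snk then x else 0) :
    ∃ (m : ℕ) (c : Fin m → ℝ) (w : Fin m → List A),
      (∀ i, 0 < c i ∧ c i ∈ G ∧ IsArcWalk tail head src snk (w i)) ∧ ∑ i, c i = x ∧
      ∀ a, y a = ∑ i, c i * mult (w i) a := by
  -- The induction is on the number of arcs that carry flow.
  obtain ⟨k, hk⟩ : ∃ k, (Finset.univ.filter fun a => y a ≠ 0).card = k := ⟨_, rfl⟩
  induction k using Nat.strong_induction_on generalizing y x with
  | _ k ih =>
  rcases hx.eq_or_lt with rfl | hx0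
  · have h1 := eq_zero_of_netOut_eq_zero hr hy (fun v => by rw [h]; simp)
    exact ⟨0, fun _ => 0, fun _ => [], fun i => i.elim0, by simp, fun a => by simp [h1]⟩
  obtain ⟨l, hl, hpos⟩ := exists_pos_walk hr hy (snk := snk)
    (fun v hv => by rw [h, if_neg hv]; split_ifs <;> simp [hx]) _ src
    (Nat.lt_add_left _ (Nat.lt_succ_self _)) (Or.inr (Or.inl (by rw [h]; simp [hne, hx0])))
  have hle := mult_le_one (hl.nodup hr)
  have hflow : ∀ c n, MiND.netOut tail head (fun a => y a - c * mult l a) n =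
      (if n = src then x - c else 0) - if n = snk then x - c else 0 := fun c n => by
    rw [netOut_sub_mul, h, hl.netOut_mult]
    split_ifs <;> ring
  have hlne : l.toFinset.Nonempty := by
    rcases l with _ | ⟨a, l⟩
    · exact absurd hl hne
    · exact ⟨a, by simp⟩
  have hnonneg : ∀ c, 0 ≤ c → (∀ a ∈ l, c ≤ y a) → ∀ a, 0 ≤ y a - c * mult l a := by
    intro c hc hcl a
    by_cases ha : a ∈ l
    · nlinarith [hcl a ha, hle a]
    · rw [mult_of_notMem ha]; simpa using hy a
  -- The arc `a₀` is the bottleneck of the walk.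
  obtain ⟨a₀, ha₀, hmin⟩ := Finset.exists_min_image l.toFinset y hlne
  simp only [List.mem_toFinset] at ha₀ hmin
  -- If the bottleneck can carry all of `x`, subtracting `x` along the walk leaves a circulation,
  -- which vanishes. Otherwise `y a₀` is subtracted: this empties `a₀`, fills no empty arc, and
  -- keeps the remaining value positive and all entries in `G`.
  rcases le_or_gt x (y a₀) with hxa | hxa
  · have h1 := eq_zero_of_netOut_eq_zero hr
      (hnonneg x hx fun a ha => hxa.trans (hmin a ha)) (fun v => by rw [hflow]; simp)
    exact ⟨1, fun _ => x, fun _ => l, fun _ => ⟨hx0, hxG, hl⟩, by simp,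
      fun a => by simpa using sub_eq_zero.1 (h1 a)⟩
  · have hc := hpos a₀ ha₀
    have hm1 : mult l a₀ = 1 := le_antisymm (hle a₀) (one_le_mult ha₀)
    obtain ⟨m, c, w, hw, hsum, hyw⟩ := ih _ (by
        rw [← hk]
        refine Finset.card_lt_card ((Finset.ssubset_iff_of_subset ?_).2 ⟨a₀, ?_, ?_⟩)
        · intro a
          simp only [Finset.mem_filter, Finset.mem_univ, true_and]
          intro ha hya
          by_cases hal : a ∈ l
          · exact (hpos a hal).ne' hya
          · exact ha (by rw [mult_of_notMem hal, hya]; simp)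
        · simpa using hc.ne'
        · simp [hm1])
      (fun a => y a - y a₀ * mult l a) (x - y a₀) (by linarith) (G.sub_mem hxG (hyG _))
      (hnonneg _ hc.le hmin) (fun a => G.sub_mem (hyG a) (mul_mult_mem (hyG _) _ _))
      (hflow _) rfl
    refine ⟨m + 1, Fin.cons (y a₀) c, Fin.cons l w, ?_, ?_, ?_⟩
    · intro i
      refine Fin.cases ?_ (fun i => ?_) i
      · exact ⟨hc, hyG _, hl⟩
      · simpa using hw i
    · simp [Fin.sum_univ_succ, hsum]
    · intro a
      simp only [Fin.sum_univ_succ, Fin.cons_zero, Fin.cons_succ, ← hyw]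
      ring

/-- An integral flow of value one is a walk. -/
theorem exists_walk_of_unit_flow {src snk : V} (hne : src ≠ snk) (y : A → ℝ)
    (hy : ∀ a, y a ∈ ({0, 1} : Set ℝ))
    (h : ∀ n, MiND.netOut tail head y n = (if n = src then 1 else 0) - if n = snk then 1 else 0) :
    ∃ w, IsArcWalk tail head src snk w ∧ ∀ a, y a = mult w a := by
  obtain ⟨m, c, w, hw, hsum, hyw⟩ := exists_walk_decomposition hr (Int.castAddHom ℝ).range hne y 1
    zero_le_one ⟨1, by simp⟩ (fun a => by rcases hy a with h | h <;> simp_all)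
    (fun a => by rcases hy a with h | h <;> [exact ⟨0, by simp_all⟩; exact ⟨1, by simp_all⟩]) h
  -- Positive integer coefficients with sum one leave room for a single walk.
  have h1 : ∀ i, 1 ≤ c i := fun i => by
    obtain ⟨h0, ⟨n, hn⟩, -⟩ := hw i
    rw [← hn] at h0 ⊢
    simp only [Int.coe_castAddHom] at h0 ⊢
    exact_mod_cast h0
  have h2 : (m : ℝ) ≤ 1 := by
    rw [← hsum]
    simpa using Finset.sum_le_sum fun i (_ : i ∈ Finset.univ) => h1 i
  have h3 : m ≤ 1 := by exact_mod_cast h2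
  interval_cases m
  · simp at hsum
  · simp only [Finset.univ_unique, Fin.default_eq_zero, Finset.sum_singleton] at hsum hyw
    exact ⟨w 0, (hw 0).2.2, fun a => by rw [hyw, hsum, one_mul]⟩

end Decomposition

end Network

/-! ### Additivity of costs, loads and pickup counts -/

namespace MiND

variable {N P S L : Type*} {Dep : L → Type*}

section Costs

variable (I : MiND N P S L Dep) (tr : I.Trip) (s : S)

/-- Cost of all pickups on a segment. -/
def segCost (e : Seg N P) : ℝ :=
  ∑ p ∈ e.pax, I.serviceCost tr s p 1 (I.walk tr.1 tr.2 s e p) (I.wait tr.1 tr.2 s e p)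
    (I.travel tr.1 tr.2 s e p)

lemma pickupSum_cons (e : Seg N P) (w : List (Seg N P)) (p : P) (f : Seg N P → ℝ) :
    pickupSum (e :: w) p f = (if p ∈ e.pax then f e else 0) + pickupSum w p f := by
  simp [pickupSum]

lemma pickupSum_append (w w' : List (Seg N P)) (p : P) (f : Seg N P → ℝ) :
    pickupSum (w ++ w') p f = pickupSum w p f + pickupSum w' p f := by
  simp [pickupSum]

lemma pickupSum_one_of_pairwise {w : List (Seg N P)}
    (hw : w.Pairwise fun e f => Disjoint e.pax f.pax) (p : P) :
    pickupSum w p (fun _ => 1) = if ∃ e ∈ w, p ∈ e.pax then 1 else 0 := by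
  induction w with
  | nil => simp [pickupSum]
  | cons e w ih =>
    rw [List.pairwise_cons] at hw
    rw [pickupSum_cons, ih hw.2]
    by_cases hp : p ∈ e.pax
    · have : ¬ ∃ f ∈ w, p ∈ f.pax := fun ⟨f, hf, hpf⟩ =>
        Finset.disjoint_left.1 (hw.1 f hf) hp hpf
      rw [if_neg this, if_pos hp, if_pos ⟨e, by simp, hp⟩, add_zero]
    · simp [hp]

/-- If no request is picked up more than once, then the pickup sets are pairwise disjoint. -/
lemma pairwise_of_pickupSum_le_one {w : List (Seg N P)}
    (hw : ∀ p, (∃ e ∈ w, p ∈ e.pax) → pickupSum w p (fun _ => 1) ≤ 1) :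
    w.Pairwise fun e f => Disjoint e.pax f.pax := by
  induction w with
  | nil => simp
  | cons e w ih =>
    have hnn : ∀ (v : List (Seg N P)) p, 0 ≤ pickupSum v p (fun _ => 1) := fun v p =>
      sum_map_ite_nonneg v _
    rw [List.pairwise_cons]
    constructor
    · intro f hf
      rw [Finset.disjoint_left]
      intro p hpe hpf
      have h1 := hw p ⟨e, by simp, hpe⟩
      obtain ⟨v, v', rfl⟩ := List.append_of_mem hf
      rw [pickupSum_cons, pickupSum_append, pickupSum_cons, if_pos hpe, if_pos hpf] at h1
      linarith [hnn v p, hnn v' p]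
    · refine ih fun p ⟨f, hf, hpf⟩ => ?_
      have h1 := hw p ⟨f, by simp [hf], hpf⟩
      rw [pickupSum_cons] at h1
      split_ifs at h1 <;> linarith

/-- The service cost is jointly linear in the number of pickups and the three times, so the cost of
the totals is the total of the costs, even with repeated pickups. -/
lemma serviceCost_pickupSum (w : List (Seg N P)) (p : P) :
    I.serviceCost tr s p (pickupSum w p fun _ => 1)
      (pickupSum w p fun e => I.walk tr.1 tr.2 s e p)
      (pickupSum w p fun e => I.wait tr.1 tr.2 s e p)
      (pickupSum w p fun e => I.travel tr.1 tr.2 s e p) =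
    pickupSum w p fun e => I.serviceCost tr s p 1 (I.walk tr.1 tr.2 s e p)
      (I.wait tr.1 tr.2 s e p) (I.travel tr.1 tr.2 s e p) := by
  induction w with
  | nil => simp [pickupSum, serviceCost]
  | cons e w ih =>
    simp only [pickupSum_cons]
    rw [← ih]
    unfold serviceCost
    split_ifs <;> ring

lemma sum_pickupSum [Fintype P] (w : List (Seg N P)) (F : P → Seg N P → ℝ) :
    ∑ p, pickupSum w p (F p) = (w.map fun e => ∑ p ∈ e.pax, F p e).sum := by
  induction w with
  | nil => simp [pickupSum]
  | cons e w ih =>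
    simp only [pickupSum_cons, Finset.sum_add_distrib, ih, List.map_cons, List.sum_cons]
    simp

variable {I tr s}

lemma Subpath.mem_pax (r : I.Subpath tr s) (p : P) : p ∈ r.pax ↔ ∃ e ∈ r.segs, p ∈ e.pax := by
  unfold Subpath.pax
  induction r.segs with
  | nil => simp
  | cons e w ih => simp [ih]

lemma Subpath.pickupSum_one (r : I.Subpath tr s) (p : P) :
    pickupSum r.segs p (fun _ => 1) = if p ∈ r.pax then 1 else 0 := by
  rw [pickupSum_one_of_pairwise r.disj]
  simp only [r.mem_pax]

/-- Disjoint pickup sets mean that no request is counted twice. -/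
lemma loadOf_foldr {w : List (Seg N P)} (hw : w.Pairwise fun e f => Disjoint e.pax f.pax) :
    I.loadOf s (w.foldr (fun e A => e.pax ∪ A) ∅) = (w.map fun e => I.loadOf s e.pax).sum := by
  induction w with
  | nil => simp [loadOf]
  | cons e w ih =>
    rw [List.pairwise_cons] at hw
    rw [List.map_cons, List.sum_cons, ← ih hw.2, List.foldr_cons]
    refine Finset.sum_union (Finset.disjoint_left.2 fun p hp hpw => ?_)
    have : ∀ v : List (Seg N P), p ∈ v.foldr (fun e A => e.pax ∪ A) ∅ → ∃ f ∈ v, p ∈ f.pax := by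
      intro v
      induction v with
      | nil => simp
      | cons f v ih => simpa using Or.imp_right ih
    obtain ⟨f, hf, hpf⟩ := this w hpw
    exact Finset.disjoint_left.1 (hw.1 f hf) hp hpf

lemma Subpath.load_eq (r : I.Subpath tr s) :
    r.load = (r.segs.map fun e => I.loadOf s e.pax).sum :=
  loadOf_foldr r.disj

/-- A served request is picked up exactly once, matching the `1` in `Subpath.cost`; for any other
request all pickup sums vanish. -/
lemma Subpath.cost_eq [Fintype P] (r : I.Subpath tr s) :
    r.cost = (r.segs.map (I.segCost tr s)).sum := by
  unfold segCost
  rw [← sum_pickupSum r.segs fun p e => I.serviceCost tr s p 1 (I.walk tr.1 tr.2 s e p)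
    (I.wait tr.1 tr.2 s e p) (I.travel tr.1 tr.2 s e p)]
  simp only [← serviceCost_pickupSum]
  have h0 : ∀ p, p ∉ r.pax → ∀ f, pickupSum r.segs p f = 0 := fun p hp f => by
    refine List.sum_eq_zero ?_
    simp only [List.mem_map]
    rintro _ ⟨e, he, rfl⟩
    exact if_neg fun hpe => hp ((r.mem_pax p).2 ⟨e, he, hpe⟩)
  unfold Subpath.cost
  rw [← Finset.sum_subset (Finset.subset_univ r.pax)]
  · refine Finset.sum_congr rfl fun p hp => ?_
    rw [r.pickupSum_one, if_pos hp]
    rfl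
  · intro p _ hp
    simp [h0 p hp, serviceCost]

lemma Path.cost_eq [Fintype P] (q : I.Path tr s) : q.cost = (q.segs.map (I.segCost tr s)).sum := by
  unfold segCost
  rw [← sum_pickupSum q.segs fun p e => I.serviceCost tr s p 1 (I.walk tr.1 tr.2 s e p)
    (I.wait tr.1 tr.2 s e p) (I.travel tr.1 tr.2 s e p)]
  simp only [← serviceCost_pickupSum]
  rfl

lemma sum_map_flatMap {α β M : Type*} [AddMonoid M] (l : List α) (g : α → List β) (f : β → M) :
    ((l.flatMap g).map f).sum = (l.map fun a => ((g a).map f).sum).sum := by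
  induction l with
  | nil => simp
  | cons a l ih => simp [ih]

lemma Path.cost_eq_sum_legs [Fintype P] (q : I.Path tr s) :
    q.cost = (q.legs.map Subpath.cost).sum := by
  rw [q.cost_eq, Path.segs, sum_map_flatMap]
  simp only [← Subpath.cost_eq]

lemma Path.count_eq_sum_legs (q : I.Path tr s) (p : P) :
    q.count p = (q.legs.map fun r => if p ∈ r.pax then (1 : ℝ) else 0).sum := by
  unfold Path.count pickupSum Path.segs
  rw [sum_map_flatMap]
  simp only [← Subpath.pickupSum_one]
  rfl

end Costs

end MiND

/-! ### Auxiliary identities for weighted combinations -/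

section Combinations

/-- Translates the right-hand side of the flow balance in the formulations into that of the
decomposition. The decidability instances are arbitrary so that it fits every occurrence. -/
lemma ite_value_eq {V : Type*} {src snk : V} (hne : src ≠ snk) (x : ℝ) (n : V)
    {d₁ d₃ : Decidable (n = src)} {d₂ d₄ : Decidable (n = snk)} :
    @ite _ _ d₁ x (@ite _ _ d₂ (-x) 0) = @ite _ _ d₃ x 0 - @ite _ _ d₄ x 0 := by
  by_cases h : n = src
  · subst h; simp [hne]
  · simp only [h, if_false]; split_ifs <;> simp

/-- Arcs without a subpath or segment contribute zero, so sums along a walk reduce to sums over the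
subpaths or segments it contains. -/
lemma sum_map_filterMap {α β M : Type*} [AddCommMonoid M] (o : α → Option β) (f : α → M)
    (g : β → M) (h : ∀ a, f a = (o a).elim 0 g) (l : List α) :
    (l.map f).sum = ((l.filterMap o).map g).sum := by
  induction l with
  | nil => simp
  | cons a l ih =>
    rw [List.map_cons, List.sum_cons, ih, h a, List.filterMap_cons]
    cases o a <;> simp

/-- Different walks of a decomposition may give the same path; their coefficients are added up over
the fibers of `q`. -/
lemma sum_mul_sum_fiber {ι Q : Type*} [Fintype ι] [Fintype Q] (q : ι → Q) (c : ι → ℝ)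
    (f : Q → ℝ) : ∑ k, f k * ∑ i with q i = k, c i = ∑ i, c i * f (q i) := by
  rw [← Finset.sum_fiberwise Finset.univ q]
  refine Finset.sum_congr rfl fun k _ => ?_
  rw [Finset.mul_sum]
  refine Finset.sum_congr rfl fun i hi => ?_
  rw [(Finset.mem_filter.1 hi).2, mul_comm]

/-- A combination of disjoint choices stays in the unit interval and in the additive group of its
coefficients. -/
lemma sum_mul_mult_mem {ι A : Type*} [Fintype ι] {G : AddSubgroup ℝ} {c : ι → ℝ}
    (hc : ∀ i, c i ∈ Set.Icc (0 : ℝ) 1 ∩ G) (hsum : ∑ i, c i ≤ 1) {w : ι → List A} {a : A}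
    (hw : ∀ i, mult (w i) a ≤ 1) :
    ∑ i, c i * mult (w i) a ∈ Set.Icc (0 : ℝ) 1 ∩ (G : Set ℝ) := by
  refine ⟨⟨Finset.sum_nonneg fun i _ => mul_nonneg (hc i).1.1 (mult_nonneg _ _), ?_⟩,
    G.sum_mem fun i _ => mul_mult_mem (hc i).2 _ _⟩
  refine le_trans (Finset.sum_le_sum fun i _ => ?_) hsum
  exact mul_le_of_le_one_right (hc i).1.1 (hw i)

end Combinations

/-! ### Paths and flows in the load-expanded network -/

namespace MiND

variable {N P S L : Type*} {Dep : L → Type*}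

section LoadNetwork

variable {I : MiND N P S L Dep} {tr : I.Trip} {s : S}

/-- The subpath of a traveling arc. -/
def LArc.leg : I.LArc tr s → Option (I.Subpath tr s)
  | .inl a => some a.1.1
  | .inr _ => none

lemma LArc.cost_eq (a : I.LArc tr s) : a.cost = a.leg.elim 0 Subpath.cost := by
  rcases a with a | a <;> rfl

lemma LArc.ite_pax (p : P) (a : I.LArc tr s) : (if p ∈ a.pax then (1 : ℝ) else 0) =
    a.leg.elim 0 fun r => if p ∈ r.pax then (1 : ℝ) else 0 := by
  rcases a with a | a
  · exact if_congr Iff.rfl rfl rfl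
  · simp [LArc.leg, LArc.pax]

/-- The position of a node of the load-expanded network along the line. -/
def LNode.rank : Option (I.LNode tr) → ℕ
  | none => I.nCP tr.1
  | some n => n.1

lemma LArc.rank_lt (a : I.LArc tr s) : LNode.rank a.tail < LNode.rank a.head := by
  rcases a with ⟨⟨r, n, m⟩, h1, h2, h3⟩ | n
  · simp only at h1 h2
    simp only [LArc.tail, LArc.head, LNode.rank, h1, h2]
    exact r.pair_mem.1
  · exact n.1.1.isLt

/-- A sequence of subpaths from a node to the final checkpoint that respects the capacity is a walk
to the sink of the load-expanded network. -/
lemma Chained.exists_arcWalk (l : List (I.Subpath tr s)) (n : I.LNode tr)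
    (h : Chained n.1 (I.last tr) l) (hcap : n.2 + (l.map Subpath.load).sum ≤ I.cap tr.1) :
    ∃ w : List (I.LArc tr s), IsArcWalk LArc.tail LArc.head (some n) none w ∧
      w.filterMap LArc.leg = l := by
  induction l generalizing n with
  | nil => exact ⟨[.inr ⟨n, h⟩], ⟨rfl, rfl⟩, rfl⟩
  | cons r l ih =>
    rw [List.map_cons, List.sum_cons] at hcap
    obtain ⟨w, hw, hl⟩ := ih (r.dst, ⟨n.2 + r.load, by omega⟩) h.2 (by simp only; omega)
    exact ⟨.inl ⟨(r, n, _), h.1.symm, rfl, rfl⟩ :: w, ⟨rfl, hw⟩, by simp [LArc.leg, hl]⟩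

/-- A walk to the sink of the load-expanded network is a sequence of subpaths to the final
checkpoint that respects the capacity. -/
lemma LArc.chained_of_arcWalk (w : List (I.LArc tr s)) (n : I.LNode tr)
    (h : IsArcWalk LArc.tail LArc.head (some n) none w) :
    Chained n.1 (I.last tr) (w.filterMap LArc.leg) ∧
      n.2 + ((w.filterMap LArc.leg).map Subpath.load).sum ≤ I.cap tr.1 := by
  induction w generalizing n with
  | nil => cases h
  | cons a w ih =>
    rcases a with ⟨⟨r, n', m⟩, h1, h2, h3⟩ | n'
    · obtain ⟨ha, hw⟩ := h
      obtain rfl : n' = n := Option.some.inj ha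
      obtain ⟨hc, hl⟩ := ih m hw
      simp only at h1 h2 h3
      change Chained n'.1 (I.last tr) (r :: w.filterMap LArc.leg) ∧
        n'.2 + (List.map Subpath.load (r :: w.filterMap LArc.leg)).sum ≤ I.cap tr.1
      rw [List.map_cons, List.sum_cons]
      exact ⟨⟨h1.symm, h2 ▸ hc⟩, by omega⟩
    · obtain ⟨ha, hw⟩ := h
      obtain rfl : n'.1 = n := Option.some.inj ha
      -- No arc leaves the sink, so a terminating arc ends the walk.
      have hnil : w = [] := by
        rcases w with _ | ⟨b, w⟩
        · rfl
        · have := hw.1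
          rcases b with b | b <;> cases this
      subst hnil
      have := n'.1.2.isLt
      exact ⟨n'.2, show (n'.1.2 : ℕ) + 0 ≤ _ by omega⟩

variable [Fintype N] [Fintype P]

/-- A flow in the load-expanded network comes from a combination of paths. -/
lemma exists_path_combination {G : AddSubgroup ℝ} {y : I.LArc tr s → ℝ} {x : ℝ}
    (hx : x ∈ Set.Icc (0 : ℝ) 1 ∩ G) (hy : ∀ a, y a ∈ Set.Icc (0 : ℝ) 1 ∩ G)
    (hflow : ∀ n, netOut LArc.tail LArc.head y n =
      if n = some (I.first tr, 0) then x else if n = none then - x else 0) :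
    ∃ ζ : I.Path tr s → ℝ, (∀ q, ζ q ∈ Set.Icc (0 : ℝ) 1 ∩ G) ∧ ∑ q, ζ q = x ∧
      (∀ p, ∑ q, q.count p * ζ q = ∑ a : I.LArc tr s with p ∈ a.pax, y a) ∧
      ∑ q, q.cost * ζ q = ∑ a, a.cost * y a := by
  obtain ⟨m, c, w, hw, hsum, hyw⟩ := exists_walk_decomposition
    (rk := LNode.rank) LArc.rank_lt G (Option.some_ne_none _) y x hx.1.1 hx.2
    (fun a => (hy a).1.1) (fun a => (hy a).2)
    (fun n => (hflow n).trans (ite_value_eq (Option.some_ne_none _) _ _))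
  have hch := fun i => LArc.chained_of_arcWalk _ _ (hw i).2.2
  let q : Fin m → I.Path tr s := fun i => ⟨(w i).filterMap LArc.leg, (hch i).1, by
    have := (hch i).2; omega⟩
  have hζ : ∀ f : I.Path tr s → ℝ, ∑ k, f k * ∑ i with q i = k, c i = ∑ i, c i * f (q i) :=
    sum_mul_sum_fiber q c
  have hζx : ∑ k, ∑ i with q i = k, c i = x := by simpa [hsum] using hζ fun _ => 1
  have hnn : ∀ k, 0 ≤ ∑ i with q i = k, c i := fun k => Finset.sum_nonneg fun i _ => (hw i).1.le
  refine ⟨fun k => ∑ i with q i = k, c i, fun k => ⟨⟨hnn k, ?_⟩,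
    G.sum_mem fun i _ => (hw i).2.1⟩, hζx, fun p => ?_, ?_⟩
  · refine le_trans ?_ (hζx.le.trans hx.1.2)
    exact Finset.single_le_sum (f := fun k => ∑ i with q i = k, c i) (fun k _ => hnn k)
      (Finset.mem_univ k)
  · rw [hζ]
    simp only [hyw]
    rw [sum_filter_sum_mult]
    refine Finset.sum_congr rfl fun i _ => ?_
    rw [Path.count_eq_sum_legs, sum_map_filterMap LArc.leg _ _ (LArc.ite_pax p)]
  · rw [hζ]
    simp only [hyw]
    rw [sum_mul_sum_mult]
    refine Finset.sum_congr rfl fun i _ => ?_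
    rw [Path.cost_eq_sum_legs, sum_map_filterMap LArc.leg _ _ LArc.cost_eq]

/-- A combination of paths gives a flow in the load-expanded network. -/
lemma exists_load_flow {G : AddSubgroup ℝ} {ζ : I.Path tr s → ℝ} {x : ℝ} (hx : x ≤ 1)
    (hζ : ∀ q, ζ q ∈ Set.Icc (0 : ℝ) 1 ∩ G) (hsum : ∑ q, ζ q = x) :
    ∃ y : I.LArc tr s → ℝ, (∀ a, y a ∈ Set.Icc (0 : ℝ) 1 ∩ G) ∧
      (∀ n, netOut LArc.tail LArc.head y n =
        if n = some (I.first tr, 0) then x else if n = none then - x else 0) ∧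
      (∀ p, ∑ a : I.LArc tr s with p ∈ a.pax, y a = ∑ q, q.count p * ζ q) ∧
      ∑ a, a.cost * y a = ∑ q, q.cost * ζ q := by
  have hex := fun q : I.Path tr s => Chained.exists_arcWalk q.legs (I.first tr, 0) q.chained
    (by simpa using q.load_le)
  choose w hw hl using hex
  refine ⟨fun a => ∑ q, ζ q * mult (w q) a, fun a => sum_mul_mult_mem hζ (hsum.le.trans hx)
    fun q => mult_le_one ((hw q).nodup (rk := LNode.rank) LArc.rank_lt) a, fun n => ?_,
    fun p => ?_, ?_⟩
  · rw [netOut_sum_mult ζ w hw, hsum]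
    exact (ite_value_eq (Option.some_ne_none _) _ _).symm
  · rw [sum_filter_sum_mult]
    refine Finset.sum_congr rfl fun q _ => ?_
    rw [Path.count_eq_sum_legs, sum_map_filterMap LArc.leg _ _ (LArc.ite_pax p), hl, mul_comm]
  · rw [sum_mul_sum_mult]
    refine Finset.sum_congr rfl fun q _ => ?_
    rw [Path.cost_eq_sum_legs, sum_map_filterMap LArc.leg _ _ LArc.cost_eq, hl, mul_comm]

end LoadNetwork

/-- The path-based and the subpath-based formulation have the same objective values. -/
theorem pathValues_eq_subpathValues [Fintype N] [Fintype P] [Fintype L] [∀ ℓ, Fintype (Dep ℓ)]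
    (I : MiND N P S L Dep) (s : S) (G : AddSubgroup ℝ) {x : I.Trip → ℝ} (z : I.Trip → P → ℝ)
    (hx : ∀ tr, x tr ∈ Set.Icc (0 : ℝ) 1 ∩ G) :
    I.pathValues s (Set.Icc 0 1 ∩ G) x z = I.subpathValues s (Set.Icc 0 1 ∩ G) x z := by
  ext v
  constructor
  · rintro ⟨ζ, hdom, hsum, hpax, rfl⟩
    choose y hy hflow hcount hcost using
      fun tr => exists_load_flow (hx tr).1.2 (hdom tr) (hsum tr)
    exact ⟨y, hy, hflow, fun tr p hp => (hcount tr p).trans_le (hpax tr p hp),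
      Finset.sum_congr rfl fun tr _ => (hcost tr).symm⟩
  · rintro ⟨y, hdom, hflow, hpax, rfl⟩
    choose ζ hζ hsum hcount hcost using
      fun tr => exists_path_combination (hx tr) (hdom tr) (hflow tr)
    exact ⟨ζ, hζ, hsum, fun tr p hp => (hcount tr p).trans_le (hpax tr p hp),
      Finset.sum_congr rfl fun tr _ => (hcost tr).symm⟩

end MiND

/-! ### From paths to flows in the time-load-expanded network -/

namespace MiND

variable {N P S L : Type*} {Dep : L → Type*}

section TimeNetwork

variable {I : MiND N P S L Dep} {tr : I.Trip} {s : S}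

/-- The checkpoint pair of a subpath. -/
def Subpath.pair (r : I.Subpath tr s) : I.Gam tr := ⟨(r.src, r.dst), r.pair_mem⟩

lemma Chained.arcWalk_pair {i j : I.CP tr} {l : List (I.Subpath tr s)} (h : Chained i j l) :
    IsArcWalk (fun g : I.Gam tr => g.1.1) (fun g : I.Gam tr => g.1.2) i j
      (l.map Subpath.pair) := by
  induction l generalizing i with
  | nil => exact h
  | cons r l ih => exact ⟨h.1, ih h.2⟩

lemma Gam.rank_lt (g : I.Gam tr) : (g.1.1 : ℕ) < g.1.2 := g.2.1

lemma first_ne_last : I.first tr ≠ I.last tr := by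
  have := I.two_le_nCP tr.1
  intro h
  have h1 := congrArg Fin.val h
  simp only [first, last] at h1
  omega

lemma T_le_T_last (i : I.CP tr) : I.T tr i ≤ I.T tr (I.last tr) :=
  (I.sched_strictMono tr.1 tr.2).monotone (by
    rw [Fin.le_def]; simp only [last]; have := i.isLt; omega)

variable {ρ : ℝ} [Fintype L] [∀ ℓ, Fintype (Dep ℓ)]

/-- The segment of a traveling arc. -/
def TArc.seg : I.TArc tr s ρ → Option (Seg N P)
  | .inl a => some a.1.1
  | .inr _ => none

lemma TArc.cost_eq (a : I.TArc tr s ρ) : a.cost = a.seg.elim 0 (I.segCost tr s) := by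
  rcases a with a | a <;> rfl

lemma TArc.ite_pax (p : P) (a : I.TArc tr s ρ) : (if p ∈ a.pax then (1 : ℝ) else 0) =
    a.seg.elim 0 fun e => if p ∈ e.pax then (1 : ℝ) else 0 := by
  rcases a with a | a
  · exact if_congr Iff.rfl rfl rfl
  · simp [TArc.seg, TArc.pax]

/-- The time index of a node of the time-load-expanded network; the sink is behind the horizon. -/
def TNode.rank : Option (I.TNode tr ρ) → ℕ
  | none => I.horizon ρ + 1
  | some n => n.2.2

/-- Travel times are positive, so rounding up makes each traveling arc last at least one time step.
-/
lemma TArc.rank_lt (hρ : 0 < ρ) (a : I.TArc tr s ρ) : TNode.rank a.tail < TNode.rank a.head := by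
  rcases a with ⟨⟨e, n, m⟩, h1, h2, h3, h4⟩ | ⟨⟨n, m⟩, h1, h2, h3⟩ | n
  · have : 0 < ⌈I.tt e.road / ρ⌉₊ := Nat.ceil_pos.2 (div_pos (I.tt_pos _ h1.1) hρ)
    simp only [TArc.tail, TArc.head, TNode.rank] at h4 ⊢
    omega
  · simp only [TArc.tail, TArc.head, TNode.rank] at h3 ⊢
    omega
  · exact n.1.2.2.isLt

/-- Both ends of the arc lie in the space-time region of the checkpoint pair `(i, j)`. -/
def TArc.InRegion (a : I.TArc tr s ρ) (i j : I.CP tr) : Prop :=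
  ∃ n m, a.tail = some n ∧ a.head = some m ∧ TNode.InRegion n i j ∧ TNode.InRegion m i j

lemma le_horizon (hρ : 0 < ρ) {i : I.CP tr} {k : ℕ} (hk : I.T tr i = k * ρ) :
    k ≤ I.horizon ρ := by
  have h1 := T_le_T_last i
  rw [hk, ← le_div_iff₀ hρ] at h1
  have h2 : k ≤ ⌈I.T tr (I.last tr) / ρ⌉₊ := by exact_mod_cast h1.trans (Nat.le_ceil _)
  exact h2.trans
    (Finset.le_sup (f := fun tr : I.Trip => ⌈I.T tr (I.last tr) / ρ⌉₊) (Finset.mem_univ tr))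

/-- The segments are driven without pause. The last clause ties the ends of each arc to a road of
`w`, from which the deviation bound is read off later. -/
lemma exists_travel_walk (w : List (Seg N P)) (hw : ∀ e ∈ w, e ∈ I.segments tr s)
    (n : I.TNode tr ρ) (v : N) (hwalk : IsWalk n.1 v w)
    (hcap : n.2.1 + (w.map fun e => I.loadOf s e.pax).sum ≤ I.cap tr.1)
    (hhor : n.2.2 + (w.map fun e => ⌈I.tt e.road / ρ⌉₊).sum ≤ I.horizon ρ) :
    ∃ (l : List (I.TArc tr s ρ)) (m : I.TNode tr ρ),
      IsArcWalk TArc.tail TArc.head (some n) (some m) l ∧ l.filterMap TArc.seg = w ∧ m.1 = v ∧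
      (m.2.1 : ℕ) = n.2.1 + (w.map fun e => I.loadOf s e.pax).sum ∧
      (m.2.2 : ℕ) = n.2.2 + (w.map fun e => ⌈I.tt e.road / ρ⌉₊).sum ∧
      ∀ a ∈ l, ∃ n' m', a.tail = some n' ∧ a.head = some m' ∧
        ∃ e ∈ w, e.road = (n'.1, m'.1) := by
  induction w generalizing n with
  | nil => exact ⟨[], n, rfl, rfl, hwalk, by simp, by simp, by simp⟩
  | cons e w ih =>
    rw [List.map_cons, List.sum_cons] at hcap hhor
    obtain ⟨l, m, hl, hseg, hv, hload, htime, hends⟩ := ih (fun e he => hw e (by simp [he]))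
      (e.road.2, ⟨n.2.1 + I.loadOf s e.pax, by omega⟩, ⟨n.2.2 + ⌈I.tt e.road / ρ⌉₊, by omega⟩)
      hwalk.2 (by simp only; omega) (by simp only; omega)
    simp only at hload htime
    refine ⟨.inl ⟨(e, n, _), hw e (by simp), Prod.ext hwalk.1.symm rfl, rfl, rfl⟩ :: l, m,
      ⟨rfl, hl⟩, by simp [TArc.seg, hseg], hv, ?_, ?_, ?_⟩
    · rw [List.map_cons, List.sum_cons]; omega
    · rw [List.map_cons, List.sum_cons]; omega
    · intro a ha
      rcases List.mem_cons.1 ha with rfl | ha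
      · exact ⟨n, _, rfl, rfl, e, by simp, Prod.ext hwalk.1 rfl⟩
      · obtain ⟨n', m', h1, h2, f, hf, h3⟩ := hends a ha
        exact ⟨n', m', h1, h2, f, by simp [hf], h3⟩

/-- Fills the gap between an early arrival and the scheduled time. -/
lemma exists_idle_walk (d : ℕ) (n : I.TNode tr ρ) (hhor : n.2.2 + d ≤ I.horizon ρ) :
    ∃ (l : List (I.TArc tr s ρ)) (m : I.TNode tr ρ),
      IsArcWalk TArc.tail TArc.head (some n) (some m) l ∧ l.filterMap TArc.seg = [] ∧
      m.1 = n.1 ∧ m.2.1 = n.2.1 ∧ (m.2.2 : ℕ) = n.2.2 + d ∧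
      ∀ a ∈ l, ∃ n' m', a.tail = some n' ∧ a.head = some m' ∧ n'.1 = n.1 ∧ m'.1 = n.1 := by
  induction d generalizing n with
  | zero => exact ⟨[], n, rfl, rfl, rfl, rfl, by simp, by simp⟩
  | succ d ih =>
    obtain ⟨l, m, hl, hseg, h1, h2, h3, hends⟩ := ih (n.1, n.2.1, ⟨n.2.2 + 1, by omega⟩)
      (by simp only; omega)
    simp only at h1 h2 h3 hends
    refine ⟨.inr (.inl ⟨(n, (n.1, n.2.1, ⟨n.2.2 + 1, by omega⟩)), rfl, rfl, rfl⟩) :: l, m,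
      ⟨rfl, hl⟩, hseg, h1, h2, by omega, ?_⟩
    intro a ha
    rcases List.mem_cons.1 ha with rfl | ha
    · exact ⟨n, _, rfl, rfl, rfl, rfl⟩
    · exact hends a ha

/-- With travel times rounded up to multiples of the time step, every subpath still meets its
schedule. -/
def RoundedOnTime (I : MiND N P S L Dep) (ρ : ℝ) : Prop :=
  ∀ (tr : I.Trip) (s : S) (r : I.Subpath tr s),
    ((r.segs.map fun e => ⌈I.tt e.road / ρ⌉₊).sum : ℝ) * ρ ≤ I.T tr r.dst - I.T tr r.src

/-- Idling happens at the destination of a subpath, but the deviation bound speaks only of ends of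
its segments; the destination is such an end. -/
lemma IsWalk.exists_head_eq {u v : N} {w : List (Seg N P)} (h : IsWalk u v w) (hne : u ≠ v) :
    ∃ e ∈ w, e.road.2 = v := by
  induction w generalizing u with
  | nil => exact absurd h hne
  | cons e w ih =>
    by_cases he : e.road.2 = v
    · exact ⟨e, by simp, he⟩
    · obtain ⟨f, hf, hv⟩ := ih h.2 he
      exact ⟨f, by simp [hf], hv⟩

/-- The vehicle drives along the subpath with rounded travel times, which by `hround` does not take
too long, and then idles at the destination until its scheduled time. -/
lemma Subpath.exists_arcWalk (hρ : 0 < ρ) (hgrid : I.OnGrid ρ) (hround : I.RoundedOnTime ρ)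
    (r : I.Subpath tr s) (n : I.TNode tr ρ) (hn : TNode.AtCP n r.src)
    (hcap : n.2.1 + r.load ≤ I.cap tr.1) :
    ∃ (l : List (I.TArc tr s ρ)) (m : I.TNode tr ρ),
      IsArcWalk TArc.tail TArc.head (some n) (some m) l ∧ l.filterMap TArc.seg = r.segs ∧
      TNode.AtCP m r.dst ∧ (m.2.1 : ℕ) = n.2.1 + r.load ∧
      ∀ a ∈ l, a.InRegion r.src r.dst := by
  obtain ⟨k, hk⟩ := hgrid tr r.dst
  have hkh := le_horizon hρ hk
  have hnt : ((n.2.2 : ℕ) : ℝ) * ρ = I.T tr r.src := hn.2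
  have htime : n.2.2 + (r.segs.map fun e => ⌈I.tt e.road / ρ⌉₊).sum ≤ k := by
    have h1 := hround tr s r
    rw [← hnt, hk, le_sub_iff_add_le, ← add_mul, mul_le_mul_iff_left₀ hρ] at h1
    rw [add_comm]
    exact_mod_cast h1
  rw [r.load_eq] at hcap ⊢
  obtain ⟨l, m, hl, hseg, hv, hload, hm, hends⟩ := exists_travel_walk r.segs r.segs_mem n _
    (by rw [hn.1]; exact r.walk) hcap (htime.trans hkh)
  obtain ⟨d, rfl⟩ := Nat.exists_eq_add_of_le htime
  obtain ⟨l', m', hl', hseg', h1, h2, h3, hends'⟩ :=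
    exists_idle_walk (s := s) d m (by omega)
  have hm' : TNode.time m' = I.T tr r.dst := by
    rw [hk]; unfold TNode.time; rw [h3, hm]
  have hwalk := hl.append hl'
  refine ⟨l ++ l', m', hwalk, by simp [hseg, hseg'], ⟨h1.trans hv, hm'⟩, by rw [h2, hload],
    fun a ha => ?_⟩
  -- The two checkpoints are different stations, so some segment ends at the destination, which puts
  -- the idling arcs into the region.
  obtain ⟨e, he, hed⟩ := IsWalk.exists_head_eq r.walk
    fun h => (Fin.ne_of_lt r.pair_mem.1) (I.cp_injective _ h)
  have hst : ∃ n' m'', a.tail = some n' ∧ a.head = some m'' ∧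
      n'.1 ∈ I.between tr r.src r.dst ∧ m''.1 ∈ I.between tr r.src r.dst := by
    rcases List.mem_append.1 ha with ha | ha
    · obtain ⟨n', m'', ht, hh, f, hf, hroad⟩ := hends a ha
      have := r.dev f hf
      rw [hroad] at this
      exact ⟨n', m'', ht, hh, this⟩
    · obtain ⟨n', m'', ht, hh, h4, h5⟩ := hends' a ha
      have := (r.dev e he).2
      rw [hed, ← hv] at this
      exact ⟨n', m'', ht, hh, h4 ▸ this, h5 ▸ this⟩
  obtain ⟨n', m'', ht, hh, h4, h5⟩ := hst
  -- The walk starts and ends at the two scheduled times, and time increases along it; hence every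
  -- arc lies in the time window.
  have hrk := hwalk.rank_mem (rk := TNode.rank) (TArc.rank_lt hρ) ha
  have hlt := TArc.rank_lt hρ a
  rw [ht, hh] at hrk hlt
  simp only [TNode.rank] at hrk hlt
  have hmono : ∀ {i j : ℕ}, i ≤ j → (i : ℝ) * ρ ≤ j * ρ := fun h =>
    mul_le_mul_of_nonneg_right (by exact_mod_cast h) hρ.le
  refine ⟨n', m'', ht, hh, ⟨h4, ?_⟩, ⟨h5, ?_⟩⟩ <;> rw [← hnt, ← hm'] <;>
    exact ⟨hmono (by omega), hmono (by omega)⟩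

/-- A sequence of subpaths from a scheduled checkpoint visit to the final checkpoint is a walk to
the sink of the time-load-expanded network. -/
lemma Chained.exists_time_arcWalk (hρ : 0 < ρ) (hgrid : I.OnGrid ρ) (hround : I.RoundedOnTime ρ)
    (l : List (I.Subpath tr s)) (i : I.CP tr) (h : Chained i (I.last tr) l) (n : I.TNode tr ρ)
    (hn : TNode.AtCP n i) (hcap : n.2.1 + (l.map Subpath.load).sum ≤ I.cap tr.1) :
    ∃ w : List (I.TArc tr s ρ), IsArcWalk TArc.tail TArc.head (some n) none w ∧
      w.filterMap TArc.seg = l.flatMap Subpath.segs ∧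
      (∀ a ∈ w, a.head = none ∨ ∃ r ∈ l, a.InRegion r.src r.dst) ∧
      ∀ r ∈ l, ∃ a ∈ w, ∃ m, a.head = some m ∧ TNode.AtCP m r.dst := by
  induction l generalizing i n with
  | nil =>
    cases h
    exact ⟨[.inr (.inr ⟨n, hn.1⟩)], ⟨rfl, rfl⟩, rfl, by simp [TArc.head], by simp⟩
  | cons r l ih =>
    rw [List.map_cons, List.sum_cons] at hcap
    obtain ⟨rfl, h⟩ := h
    obtain ⟨w, m, hw, hseg, hm, hload, hreg⟩ :=
      r.exists_arcWalk hρ hgrid hround n hn (by omega)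
    obtain ⟨w', hw', hseg', hreg', hvis⟩ := ih _ h m hm (by omega)
    refine ⟨w ++ w', hw.append hw', by simp [hseg, hseg'], fun a ha => ?_, fun r' hr' => ?_⟩
    · rcases List.mem_append.1 ha with ha | ha
      · exact Or.inr ⟨r, by simp, hreg a ha⟩
      · refine (hreg' a ha).imp_right fun ⟨r', hr', h⟩ => ⟨r', by simp [hr'], h⟩
    · rcases List.mem_cons.1 hr' with rfl | hr'
      · obtain ⟨a, ha, hh⟩ := hw.exists_head_eq (by
          intro hnm
          cases hnm
          have := I.cp_injective _ (hn.1.symm.trans hm.1)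
          exact (Fin.ne_of_lt r'.pair_mem.1) this)
        exact ⟨a, by simp [ha], m, hh, hm⟩
      · obtain ⟨a, ha, h⟩ := hvis r' hr'
        exact ⟨a, by simp [ha], h⟩

/-- The source of the time-load-expanded network exists and is unique. -/
lemma exists_source (hρ : 0 < ρ) (hgrid : I.OnGrid ρ) (tr : I.Trip) :
    ∃ n₀ : I.TNode tr ρ, TNode.AtCP n₀ (I.first tr) ∧ (n₀.2.1 : ℕ) = 0 ∧
      ∀ n : Option (I.TNode tr ρ), (∃ m, n = some m ∧ TNode.IsSource m) ↔ n = some n₀ := by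
  obtain ⟨k, hk⟩ := hgrid tr (I.first tr)
  refine ⟨(I.station tr (I.first tr), 0, ⟨k, Nat.lt_succ_of_le (le_horizon hρ hk)⟩),
    ⟨rfl, hk.symm⟩, rfl, fun n => ⟨?_, ?_⟩⟩
  · rintro ⟨m, rfl, ⟨h1, h2⟩, h3⟩
    rw [hk] at h2
    have h4 : (m.2.2 : ℕ) = k := by
      have := mul_right_cancel₀ hρ.ne' h2
      exact_mod_cast this
    exact congrArg some (Prod.ext h1 (Prod.ext h3 (Fin.ext h4)))
  · rintro rfl
    exact ⟨_, rfl, ⟨rfl, hk.symm⟩, rfl⟩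

variable [Fintype N] [Fintype P]

/-- A combination of paths gives a feasible flow in the time-load-expanded network. -/
lemma exists_time_flow (hρ : 0 < ρ) (hgrid : I.OnGrid ρ) (hround : I.RoundedOnTime ρ)
    {G : AddSubgroup ℝ} {ζ : I.Path tr s → ℝ} {x : ℝ} (hx : x ≤ 1)
    (hζ : ∀ q, ζ q ∈ Set.Icc (0 : ℝ) 1 ∩ G) (hsum : ∑ q, ζ q = x) :
    ∃ (ξ : I.TArc tr s ρ → ℝ) (β : I.Gam tr → ℝ),
      (∀ a, ξ a ∈ Set.Icc (0 : ℝ) 1 ∩ G) ∧ (∀ g, β g ∈ Set.Icc (0 : ℝ) 1 ∩ G) ∧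
      (∀ n, netOut TArc.tail TArc.head ξ n =
        if ∃ m, n = some m ∧ TNode.IsSource m then x else if n = none then - x else 0) ∧
      (∀ p, ∑ a : I.TArc tr s ρ with p ∈ a.pax, ξ a = ∑ q, q.count p * ζ q) ∧
      (∀ i, netOut (fun g : I.Gam tr => g.1.1) (fun g : I.Gam tr => g.1.2) β i =
        if i = I.first tr then x else if i = I.last tr then - x else 0) ∧
      (∀ i, ∑ g : I.Gam tr with g.1.2 = i, β g ≤
        ∑ a : I.TArc tr s ρ with ∃ m, a.head = some m ∧ TNode.AtCP m i, ξ a) ∧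
      (∀ (a : I.TArc tr s ρ) n m, a.tail = some n → a.head = some m →
        ξ a ≤ ∑ g : I.Gam tr with
          TNode.InRegion n g.1.1 g.1.2 ∧ TNode.InRegion m g.1.1 g.1.2, β g) ∧
      ∑ a, a.cost * ξ a = ∑ q, q.cost * ζ q := by
  obtain ⟨n₀, hn₀, hl₀, hsrc⟩ := exists_source hρ hgrid tr
  choose w hw hseg hreg hvis using fun q : I.Path tr s =>
    Chained.exists_time_arcWalk hρ hgrid hround q.legs _ q.chained n₀ hn₀
      (by simpa [hl₀] using q.load_le)
  have hγ := fun q : I.Path tr s => Chained.arcWalk_pair q.chained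
  have hwr := fun q => (hw q).nodup (rk := TNode.rank) (TArc.rank_lt hρ)
  have hγr := fun q => (hγ q).nodup (rk := Fin.val) Gam.rank_lt
  refine ⟨fun a => ∑ q, ζ q * mult (w q) a,
    fun g => ∑ q, ζ q * mult (q.legs.map Subpath.pair) g,
    fun a => sum_mul_mult_mem hζ (hsum.le.trans hx) fun q => mult_le_one (hwr q) a,
    fun g => sum_mul_mult_mem hζ (hsum.le.trans hx) fun q => mult_le_one (hγr q) g,
    fun n => ?_, fun p => ?_, fun i => ?_, fun i => ?_, fun a n m ht hh => ?_, ?_⟩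
  · rw [netOut_sum_mult ζ w hw, hsum]
    simp only [hsrc]
    exact (ite_value_eq (Option.some_ne_none _) _ _).symm
  · rw [sum_filter_sum_mult]
    refine Finset.sum_congr rfl fun q _ => ?_
    rw [sum_map_filterMap TArc.seg _ _ (TArc.ite_pax p), hseg, mul_comm]
    rfl
  · rw [netOut_sum_mult ζ _ hγ, hsum]
    exact (ite_value_eq first_ne_last _ _).symm
  -- The inequality holds path by path: the legs of a path enter checkpoint `i` at most once, and if
  -- they do, its walk has an arc arriving there on schedule.
  · rw [sum_filter_sum_mult, sum_filter_sum_mult]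
    refine Finset.sum_le_sum fun q _ => mul_le_mul_of_nonneg_left ?_ (hζ q).1.1
    rw [sum_map_ite_head]
    by_cases hi : i ∈ (q.legs.map Subpath.pair).map fun g : I.Gam tr => g.1.2
    · refine (mult_le_one ((hγ q).nodup_heads (rk := Fin.val) Gam.rank_lt) i).trans ?_
      obtain ⟨g, hg, rfl⟩ := List.mem_map.1 hi
      obtain ⟨r, hr, rfl⟩ := List.mem_map.1 hg
      obtain ⟨a, ha, h⟩ := hvis q r hr
      exact one_le_sum_map_ite ha h
    · rw [mult_of_notMem hi]
      exact sum_map_ite_nonneg _ _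
  -- Again path by path: an arc of the walk has multiplicity one and, not being terminating, lies in
  -- the region of some leg.
  · rw [sum_filter_sum_mult]
    refine Finset.sum_le_sum fun q _ => mul_le_mul_of_nonneg_left ?_ (hζ q).1.1
    by_cases ha : a ∈ w q
    · refine (mult_le_one (hwr q) a).trans ?_
      rcases hreg q a ha with h | ⟨r, hr, n', m', ht', hh', h1, h2⟩
      · rw [hh] at h; cases h
      · obtain rfl := Option.some.inj (ht.symm.trans ht')
        obtain rfl := Option.some.inj (hh.symm.trans hh')
        exact one_le_sum_map_ite (List.mem_map_of_mem (f := Subpath.pair) hr) ⟨h1, h2⟩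
    · rw [mult_of_notMem ha]
      exact sum_map_ite_nonneg _ _
  · rw [sum_mul_sum_mult]
    refine Finset.sum_congr rfl fun q _ => ?_
    rw [Path.cost_eq, sum_map_filterMap TArc.seg _ _ TArc.cost_eq, hseg, mul_comm]
    rfl

end TimeNetwork

/-- For a time step that keeps every subpath on schedule, every objective value of the path-based
formulation is one of the segment-based formulation. -/
theorem pathValues_subset_segmentValues [Fintype N] [Fintype P] [Fintype L]
    [∀ ℓ, Fintype (Dep ℓ)] (I : MiND N P S L Dep) (s : S) {ρ : ℝ} (hρ : 0 < ρ)
    (hgrid : I.OnGrid ρ) (hround : I.RoundedOnTime ρ) (G : AddSubgroup ℝ) {x : I.Trip → ℝ}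
    (z : I.Trip → P → ℝ) (hx : ∀ tr, x tr ≤ 1) :
    I.pathValues s (Set.Icc 0 1 ∩ G) x z ⊆ I.segmentValues s ρ (Set.Icc 0 1 ∩ G) x z := by
  rintro v ⟨ζ, hdom, hsum, hpax, rfl⟩
  choose ξ β hξ hβ hflow hcount hchk hvis hreg hcost using
    fun tr => exists_time_flow hρ hgrid hround (hx tr) (hdom tr) (hsum tr)
  exact ⟨ξ, β, hξ, hβ, hflow, fun tr p hp => (hcount tr p).trans_le (hpax tr p hp), hchk,
    fun tr i _ => hvis tr i, hreg, Finset.sum_congr rfl fun tr _ => (hcost tr).symm⟩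

end MiND

/-! ### Choice of the time step -/

namespace MiND

variable {N P S L : Type*} {Dep : L → Type*}

/-- If the schedule lies on a grid and every subpath is strictly faster than the schedule, then a
fine enough time step keeps every subpath on schedule. -/
theorem exists_timeStep [Fintype N] [Fintype P] [Fintype S] [Fintype L] [∀ ℓ, Fintype (Dep ℓ)]
    (I : MiND N P S L Dep) {b : ℝ} (hb : 0 < b) (hgrid : I.OnGrid b)
    (hslack : ∀ (tr : I.Trip) (s : S) (r : I.Subpath tr s),
      r.time < I.T tr r.dst - I.T tr r.src) :
    ∃ ρ : ℝ, 0 < ρ ∧ I.OnGrid ρ ∧ I.RoundedOnTime ρ := by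
  -- Steps of the form `b / m` keep the schedule on the grid. Rounding delays a subpath by at most
  -- `b / m` per segment, which tends to zero, and finitely many subpaths allow a common `m`.
  have hev : ∀ᶠ m : ℕ in Filter.atTop, ∀ (tr : I.Trip) (s : S) (r : I.Subpath tr s),
      r.time + r.segs.length * (b / m) < I.T tr r.dst - I.T tr r.src := by
    refine Filter.eventually_all.2 fun tr => Filter.eventually_all.2 fun s =>
      Filter.eventually_all.2 fun r => ?_
    have h1 : Filter.Tendsto (fun m : ℕ => r.time + r.segs.length * (b / m)) Filter.atTop
        (nhds (r.time + r.segs.length * 0)) :=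
      ((tendsto_const_div_atTop_nhds_zero_nat b).const_mul _).const_add _
    rw [mul_zero, add_zero] at h1
    exact h1.eventually_lt_const (hslack tr s r)
  obtain ⟨m, hm, hm1⟩ := (hev.and (Filter.eventually_ge_atTop 1)).exists
  have hm0 : (0 : ℝ) < m := by exact_mod_cast hm1
  have hρ : 0 < b / m := div_pos hb hm0
  refine ⟨b / m, hρ, fun tr i => ?_, fun tr s r => ?_⟩
  · obtain ⟨n, hn⟩ := hgrid tr i
    exact ⟨n * m, by rw [hn]; push_cast; field_simp⟩
  · refine le_trans ?_ (hm tr s r).le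
    have hle : ∀ w : List (Seg N P), (∀ e ∈ w, e.road ∈ I.roads) →
        ((w.map fun e => ⌈I.tt e.road / (b / m)⌉₊).sum : ℝ) * (b / m) ≤
          (w.map fun e => I.tt e.road).sum + w.length * (b / m) := by
      intro w hw
      induction w with
      | nil => simp
      | cons e w ih =>
        have h1 := ih fun f hf => hw f (by simp [hf])
        have h0 := I.tt_pos _ (hw e (by simp))
        have h2 := (Nat.ceil_lt_add_one (div_pos h0 hρ).le).le
        have h3 := mul_le_mul_of_nonneg_right h2 hρ.le
        rw [add_mul, div_mul_cancel₀ _ hρ.ne'] at h3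
        simp only [List.map_cons, List.sum_cons, List.length_cons]
        push_cast at h1 ⊢
        linarith
    exact hle r.segs fun e he => (r.segs_mem e he).1

/-! ### From integral segment-based solutions back to paths -/

section Reconstruction

variable {I : MiND N P S L Dep} {tr : I.Trip} {s : S} {ρ : ℝ} [Fintype L] [∀ ℓ, Fintype (Dep ℓ)]

lemma TArc.tail_ne_none (a : I.TArc tr s ρ) : ∃ n, a.tail = some n := by
  rcases a with a | a | a
  exacts [⟨_, rfl⟩, ⟨_, rfl⟩, ⟨_, rfl⟩]

lemma TArc.eq_nil_of_arcWalk_none {v : Option (I.TNode tr ρ)} {w : List (I.TArc tr s ρ)}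
    (h : IsArcWalk TArc.tail TArc.head none v w) : w = [] ∧ v = none := by
  rcases w with _ | ⟨a, w⟩
  · exact ⟨rfl, h.symm⟩
  · obtain ⟨n, hn⟩ := a.tail_ne_none
    exact absurd (hn.symm.trans h.1) (Option.some_ne_none n)

lemma TArc.mem_segments {a : I.TArc tr s ρ} {e : Seg N P} (h : a.seg = some e) :
    e ∈ I.segments tr s ∧ ∀ n m, a.tail = some n → a.head = some m → e.road = (n.1, m.1) := by
  rcases a with ⟨⟨e', n, m⟩, h1, h2, h3⟩ | a
  · cases h
    refine ⟨h1, fun n' m' hn hm => ?_⟩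
    cases hn; cases hm
    exact h2.symm
  · cases h

/-- Along a walk between two nodes of the time-load-expanded network, the segments form a walk in
space that is at least as fast. -/
lemma TArc.isWalk_of_arcWalk (hρ : 0 < ρ) {w : List (I.TArc tr s ρ)} {n m : I.TNode tr ρ}
    (h : IsArcWalk TArc.tail TArc.head (some n) (some m) w) :
    IsWalk n.1 m.1 (w.filterMap TArc.seg) ∧
      TNode.time n + ((w.filterMap TArc.seg).map fun e => I.tt e.road).sum ≤ TNode.time m := by
  induction w generalizing n with
  | nil => cases h; exact ⟨rfl, by simp⟩
  | cons a w ih =>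
    obtain ⟨ha, hw⟩ := h
    rcases a with ⟨⟨e, n', m'⟩, h1, h2, h3, h4⟩ | ⟨⟨n', m'⟩, h1, h2, h3⟩ | n'
    · obtain rfl : n' = n := Option.some.inj ha
      obtain ⟨hwalk, htime⟩ := ih hw
      change IsWalk n'.1 m.1 (e :: w.filterMap TArc.seg) ∧ TNode.time n' +
        (List.map (fun e : Seg N P => I.tt e.road) (e :: w.filterMap TArc.seg)).sum ≤ _
      simp only at h2 h4
      rw [List.map_cons, List.sum_cons]
      refine ⟨⟨by rw [← h2], by rw [← h2]; exact hwalk⟩, ?_⟩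
      have h5 : TNode.time n' + I.tt e.road ≤ TNode.time m' := by
        unfold TNode.time
        rw [h4]
        push_cast
        rw [add_mul]
        have := mul_le_mul_of_nonneg_right (Nat.le_ceil (I.tt e.road / ρ)) hρ.le
        rw [div_mul_cancel₀ _ hρ.ne'] at this
        linarith
      linarith
    · obtain rfl : n' = n := Option.some.inj ha
      obtain ⟨hwalk, htime⟩ := ih hw
      change IsWalk n'.1 m.1 (w.filterMap TArc.seg) ∧ TNode.time n' +
        (List.map (fun e : Seg N P => I.tt e.road) (w.filterMap TArc.seg)).sum ≤ _
      simp only at h1 h3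
      refine ⟨h1 ▸ hwalk, ?_⟩
      have h5 : TNode.time n' ≤ TNode.time m' := by
        unfold TNode.time
        rw [h3]
        push_cast
        rw [add_mul]
        linarith
      linarith
    · exact absurd (TArc.eq_nil_of_arcWalk_none hw).2 (Option.some_ne_none m)

/-- The segments along a walk to the sink fit into the vehicle. -/
lemma TArc.load_le_of_arcWalk {w : List (I.TArc tr s ρ)} {n : I.TNode tr ρ}
    (h : IsArcWalk TArc.tail TArc.head (some n) none w) :
    n.2.1 + ((w.filterMap TArc.seg).map fun e => I.loadOf s e.pax).sum ≤ I.cap tr.1 := by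
  induction w generalizing n with
  | nil => cases h
  | cons a w ih =>
    obtain ⟨ha, hw⟩ := h
    rcases a with ⟨⟨e, n', m'⟩, h1, h2, h3, h4⟩ | ⟨⟨n', m'⟩, h1, h2, h3⟩ | n'
    · obtain rfl : n' = n := Option.some.inj ha
      have hload : (m'.2.1 : ℕ) + _ ≤ _ := ih hw
      have h3' : (m'.2.1 : ℕ) = n'.2.1 + I.loadOf s e.pax := h3
      change n'.2.1 +
        (List.map (fun e : Seg N P => I.loadOf s e.pax) (e :: w.filterMap TArc.seg)).sum ≤ _
      rw [List.map_cons, List.sum_cons]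
      omega
    · obtain rfl : n' = n := Option.some.inj ha
      have hload := ih hw
      change n'.2.1 +
        (List.map (fun e : Seg N P => I.loadOf s e.pax) (w.filterMap TArc.seg)).sum ≤ _
      simp only at h2
      rw [h2]
      exact hload
    · obtain rfl : n'.1 = n := Option.some.inj ha
      obtain rfl := (TArc.eq_nil_of_arcWalk_none hw).1
      exact show (n'.1.2.1 : ℕ) + 0 ≤ _ by have := n'.1.2.1.isLt; omega

lemma TNode.time_le (hρ : 0 < ρ) {n m : I.TNode tr ρ} (h : (n.2.2 : ℕ) ≤ m.2.2) :
    TNode.time n ≤ TNode.time m :=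
  mul_le_mul_of_nonneg_right (by exact_mod_cast h) hρ.le

lemma TNode.time_lt (hρ : 0 < ρ) {n m : I.TNode tr ρ} (h : (n.2.2 : ℕ) < m.2.2) :
    TNode.time n < TNode.time m :=
  mul_lt_mul_of_pos_right (by exact_mod_cast h) hρ

/-- A walk to the sink of the time-load-expanded network that visits the checkpoints of a checkpoint
walk on schedule and stays in its regions is a sequence of subpaths. -/
lemma exists_legs (hρ : 0 < ρ) (γ : List (I.Gam tr)) (i : I.CP tr)
    (hγ : IsArcWalk (fun g : I.Gam tr => g.1.1) (fun g : I.Gam tr => g.1.2) i (I.last tr) γ)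
    (n : I.TNode tr ρ) (hn : TNode.AtCP n i) (w : List (I.TArc tr s ρ))
    (hw : IsArcWalk TArc.tail TArc.head (some n) none w)
    (hdisj : (w.filterMap TArc.seg).Pairwise fun e f => Disjoint e.pax f.pax)
    (hload : ((w.filterMap TArc.seg).map fun e => I.loadOf s e.pax).sum ≤ I.cap tr.1)
    (hreg : ∀ a ∈ w, a.head = none ∨ ∃ g ∈ γ, a.InRegion g.1.1 g.1.2)
    (hvis : ∀ g ∈ γ, ∃ a ∈ w, ∃ m, a.head = some m ∧ TNode.AtCP m g.1.2) :
    ∃ l : List (I.Subpath tr s), Chained i (I.last tr) l ∧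
      l.flatMap Subpath.segs = w.filterMap TArc.seg := by
  induction γ generalizing i n w with
  | nil =>
    refine ⟨[], hγ, ?_⟩
    rcases w with _ | ⟨a, w⟩
    · cases hw
    -- With no checkpoint pair left, no region admits an arc, so the walk is a single terminating
    -- arc.
    · have ha : a.head = none := by simpa using hreg a (by simp)
      obtain ⟨-, hw⟩ := hw
      rw [ha] at hw
      obtain rfl := (TArc.eq_nil_of_arcWalk_none hw).1
      rcases a with a | a | a
      · cases ha
      · cases ha
      · rfl
  | cons g γ ih =>
    obtain ⟨rfl, hγ⟩ := hγ
    have hmono := (I.sched_strictMono tr.1 tr.2)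
    -- All later pairs start no earlier than the scheduled time at the end of `g`, so that time
    -- separates the regions of `g` and of `γ`.
    have hafter : ∀ g' ∈ γ, I.T tr g.1.2 ≤ I.T tr g'.1.1 := fun g' hg' =>
      hmono.monotone (hγ.rank_mem (rk := Fin.val) Gam.rank_lt hg').1
    obtain ⟨a, ha, m, hm, hmat⟩ := hvis g (by simp)
    -- The walk is cut at its scheduled arrival at the end of `g`; `w₁` becomes the subpath and `w₂`
    -- goes to the induction.
    obtain ⟨w₁, w₂, rfl, hw₁, hw₂⟩ := hw.split ha
    rw [hm] at hw₁ hw₂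
    have hrk₁ := fun b (hb : b ∈ w₁) => hw₁.rank_mem (rk := TNode.rank) (TArc.rank_lt hρ) hb
    have hrk₂ := fun b (hb : b ∈ w₂) => hw₂.rank_mem (rk := TNode.rank) (TArc.rank_lt hρ) hb
    -- An arc before the cut ends by the separating time. In the region of a later pair it would
    -- start no earlier than that, but every arc with both ends in a region takes positive time.
    have hreg₁ : ∀ b ∈ w₁, b.InRegion g.1.1 g.1.2 := by
      intro b hb
      have h1 := (hrk₁ b hb).2
      have hlt := TArc.rank_lt hρ b
      rcases hreg b (by simp [hb]) with h | ⟨g', hg', h⟩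
      · rw [h] at h1
        simp only [TNode.rank] at h1
        omega
      rcases List.mem_cons.1 hg' with rfl | hg'
      · exact h
      obtain ⟨n', m', ht, hh, hn', hm'⟩ := h
      rw [ht, hh] at hlt
      rw [hh] at h1
      have h2 := TNode.time_le hρ h1
      have h3 := TNode.time_lt hρ hlt
      have h4 := hafter g' hg'
      have h5 := hn'.2.1
      rw [hmat.2] at h2
      linarith
    -- The mirror image: an arc behind the cut ends too late for the region of `g`.
    have hreg₂ : ∀ b ∈ w₂, b.head = none ∨ ∃ g ∈ γ, b.InRegion g.1.1 g.1.2 := by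
      intro b hb
      refine (hreg b (by simp [hb])).imp_right ?_
      rintro ⟨g', hg', h⟩
      rcases List.mem_cons.1 hg' with rfl | hg'
      · obtain ⟨n', m', ht, hh, hn', hm'⟩ := h
        have h1 := (hrk₂ b hb).1
        have hlt := TArc.rank_lt hρ b
        rw [ht, hh] at hlt
        rw [ht] at h1
        have h2 := TNode.time_le hρ h1
        have h3 := TNode.time_lt hρ hlt
        have h5 := hm'.2.2
        rw [hmat.2] at h2
        linarith
      · exact ⟨g', hg', h⟩
    -- Later pairs end strictly after the separating time, so their visits cannot occur in `w₁`.
    have hvis₂ : ∀ g ∈ γ, ∃ a ∈ w₂, ∃ m, a.head = some m ∧ TNode.AtCP m g.1.2 := by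
      intro g' hg'
      obtain ⟨b, hb, m', hh, hm'⟩ := hvis g' (by simp [hg'])
      rcases List.mem_append.1 hb with hb | hb
      · have h1 := (hrk₁ b hb).2
        rw [hh] at h1
        have h2 := TNode.time_le hρ h1
        have h3 := hafter g' hg'
        have h4 : I.T tr g'.1.1 < I.T tr g'.1.2 := hmono g'.2.1
        rw [hmat.2, hm'.2] at h2
        linarith
      · exact ⟨b, hb, m', hh, hm'⟩
    rw [List.filterMap_append] at hdisj hload
    rw [List.map_append, List.sum_append] at hload
    rw [List.pairwise_append] at hdisj
    obtain ⟨l, hl, hseg⟩ := ih _ hγ m hmat w₂ hw₂ hdisj.2.1 (by omega) hreg₂ hvis₂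
    obtain ⟨hwalk, htime⟩ := TArc.isWalk_of_arcWalk hρ hw₁
    have hmem : ∀ e ∈ w₁.filterMap TArc.seg, e ∈ I.segments tr s ∧
        e.road.1 ∈ I.between tr g.1.1 g.1.2 ∧ e.road.2 ∈ I.between tr g.1.1 g.1.2 := by
      intro e he
      obtain ⟨b, hb, hbe⟩ := List.mem_filterMap.1 he
      obtain ⟨n', m', ht, hh, hn', hm'⟩ := hreg₁ b hb
      obtain ⟨h1, h2⟩ := TArc.mem_segments hbe
      rw [h2 n' m' ht hh]
      exact ⟨h1, hn'.1, hm'.1⟩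
    refine ⟨⟨g.1.1, g.1.2, w₁.filterMap TArc.seg, g.2, ?_, fun e he => (hmem e he).1,
      fun e he => (hmem e he).2, hdisj.1, by omega, ?_⟩ :: l, ⟨rfl, hl⟩, ?_⟩
    · rw [← hn.1, ← hmat.1]; exact hwalk
    -- Rounding up only lengthens travel, so the true travel time fits between the two scheduled
    -- visits.
    · rw [← hn.2, ← hmat.2]; linarith
    · rw [List.flatMap_cons, hseg, List.filterMap_append]

lemma exists_ne_zero_of_one_le_sum {A : Type*} [Fintype A] {Q : A → Prop} [DecidablePred Q]
    {f : A → ℝ} (h : 1 ≤ ∑ a with Q a, f a) : ∃ a, Q a ∧ f a ≠ 0 := by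
  obtain ⟨a, ha, hfa⟩ := Finset.exists_ne_zero_of_sum_ne_zero (by linarith : ∑ a with Q a, f a ≠ 0)
  exact ⟨a, (Finset.mem_filter.1 ha).2, hfa⟩

lemma mem_of_mult_ne_zero {A : Type*} {l : List A} {a : A} (h : mult l a ≠ 0) : a ∈ l := by
  by_contra ha
  exact h (mult_of_notMem ha)

variable [Fintype N] [Fintype P]

/-- An integral feasible solution of the segment-based formulation selects at most one path. -/
lemma exists_path_of_time_flow (hρ : 0 < ρ) (hgrid : I.OnGrid ρ) {x : ℝ} {z : P → ℝ}
    (hx : x ∈ ({0, 1} : Set ℝ)) (hz : ∀ p, z p ≤ 1) {ξ : I.TArc tr s ρ → ℝ} {β : I.Gam tr → ℝ}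
    (hξ : ∀ a, ξ a ∈ ({0, 1} : Set ℝ)) (hβ : ∀ g, β g ∈ ({0, 1} : Set ℝ))
    (hflow : ∀ n, netOut TArc.tail TArc.head ξ n =
      if ∃ m, n = some m ∧ TNode.IsSource m then x else if n = none then - x else 0)
    (hpax : ∀ p, I.Compatible tr p → ∑ a : I.TArc tr s ρ with p ∈ a.pax, ξ a ≤ z p)
    (hchk : ∀ i, netOut (fun g : I.Gam tr => g.1.1) (fun g : I.Gam tr => g.1.2) β i =
        if i = I.first tr then x else if i = I.last tr then - x else 0)
    (hvis : ∀ i, i ≠ I.first tr → ∑ g : I.Gam tr with g.1.2 = i, β g ≤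
        ∑ a : I.TArc tr s ρ with ∃ m, a.head = some m ∧ TNode.AtCP m i, ξ a)
    (hreg : ∀ (a : I.TArc tr s ρ) n m, a.tail = some n → a.head = some m →
        ξ a ≤ ∑ g : I.Gam tr with
          TNode.InRegion n g.1.1 g.1.2 ∧ TNode.InRegion m g.1.1 g.1.2, β g) :
    ∃ ζ : I.Path tr s → ℝ, (∀ q, ζ q ∈ ({0, 1} : Set ℝ)) ∧ ∑ q, ζ q = x ∧
      (∀ p, ∑ q, q.count p * ζ q = ∑ a : I.TArc tr s ρ with p ∈ a.pax, ξ a) ∧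
      ∑ q, q.cost * ζ q = ∑ a, a.cost * ξ a := by
  have hr := TArc.rank_lt (tr := tr) (s := s) hρ
  rcases hx with rfl | hx
  -- For `x = 0` the flow is a circulation in an acyclic network.
  · have h0 := eq_zero_of_netOut_eq_zero (y := ξ) (rk := TNode.rank) hr
      (fun a => by rcases hξ a with h | (h : ξ a = 1) <;> linarith)
      (fun n => by rw [hflow]; simp)
    exact ⟨fun _ => 0, fun _ => Or.inl rfl, by simp, fun p => by simp [h0], by simp [h0]⟩
  rw [Set.mem_singleton_iff] at hx
  subst hx
  obtain ⟨n₀, hn₀, hl₀, hsrc⟩ := exists_source hρ hgrid tr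
  obtain ⟨w, hw, hξw⟩ := exists_walk_of_unit_flow (rk := TNode.rank) hr
    (Option.some_ne_none n₀) ξ hξ (fun n => by
      rw [hflow]; simp only [hsrc]
      exact ite_value_eq (Option.some_ne_none _) _ _)
  obtain ⟨γ, hγ, hβγ⟩ := exists_walk_of_unit_flow (rk := Fin.val) Gam.rank_lt first_ne_last β hβ
    (fun i => (hchk i).trans (ite_value_eq first_ne_last _ _))
  have hcount : ∀ p, pickupSum (w.filterMap TArc.seg) p (fun _ => 1) =
      ∑ a : I.TArc tr s ρ with p ∈ a.pax, ξ a := fun p => by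
    simp only [hξw]
    rw [sum_filter_mult, sum_map_filterMap TArc.seg _ _ (TArc.ite_pax p)]
    rfl
  have hload := TArc.load_le_of_arcWalk hw
  -- A request picked up on an available segment is compatible, so the assignment constraint and
  -- `hz` allow it only one pickup.
  have hdisj : (w.filterMap TArc.seg).Pairwise fun e f => Disjoint e.pax f.pax := by
    refine pairwise_of_pickupSum_le_one fun p ⟨e, he, hp⟩ => ?_
    obtain ⟨a, -, ha⟩ := List.mem_filterMap.1 he
    rw [hcount]
    exact (hpax p ((TArc.mem_segments ha).1.2 p hp).1).trans (hz p)
  obtain ⟨l, hl, hseg⟩ := exists_legs hρ γ _ hγ n₀ hn₀ w hw hdisj (by omega)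
    (fun a ha => by
      obtain ⟨n, hn⟩ := a.tail_ne_none
      rcases hh : a.head with _ | m
      · exact Or.inl rfl
      · have h1 := one_le_mult ha
        rw [← hξw] at h1
        -- An arc used by `ξ` needs a pair selected by `β` whose region contains it.
        obtain ⟨g, ⟨hg1, hg2⟩, hg⟩ := exists_ne_zero_of_one_le_sum (h1.trans (hreg a n m hn hh))
        rw [hβγ] at hg
        exact Or.inr ⟨g, mem_of_mult_ne_zero hg, n, m, hn, hh, hg1, hg2⟩)
    (fun g hg => by
      -- The visit constraint excludes the first checkpoint, which is never the end of a pair.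
      have hne : g.1.2 ≠ I.first tr := by
        intro h
        have h1 : (g.1.1 : ℕ) < g.1.2 := g.2.1
        rw [h] at h1
        simp [first] at h1
      have h1 := one_le_sum_map_ite (Q := fun g' : I.Gam tr => g'.1.2 = g.1.2) hg rfl
      rw [← sum_filter_mult] at h1
      simp only [← hβγ] at h1
      obtain ⟨a, hm, ha⟩ := exists_ne_zero_of_one_le_sum (h1.trans (hvis _ hne))
      rw [hξw] at ha
      exact ⟨a, mem_of_mult_ne_zero ha, hm⟩)
  have hlsum : (l.map Subpath.load).sum =
      ((w.filterMap TArc.seg).map fun e => I.loadOf s e.pax).sum := by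
    rw [← hseg, sum_map_flatMap]
    simp only [← Subpath.load_eq]
  let q₀ : I.Path tr s := ⟨l, hl, by omega⟩
  have hq₀ : q₀.segs = w.filterMap TArc.seg := hseg
  refine ⟨fun q => if q = q₀ then 1 else 0, fun q => ?_, by simp, fun p => ?_, ?_⟩
  · dsimp only
    split_ifs <;> simp
  · rw [← hcount]
    simp only [mul_ite, mul_one, mul_zero, Finset.sum_ite_eq', Finset.mem_univ, if_true]
    unfold Path.count
    rw [hq₀]
  · simp only [mul_ite, mul_one, mul_zero, Finset.sum_ite_eq', Finset.mem_univ, if_true, hξw]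
    rw [sum_mul_mult, Path.cost_eq, sum_map_filterMap TArc.seg _ _ TArc.cost_eq, hq₀]

end Reconstruction

/-- Every objective value of the segment-based integer program is one of the path-based integer
program. -/
theorem segmentValues_subset_pathValues [Fintype N] [Fintype P] [Fintype L]
    [∀ ℓ, Fintype (Dep ℓ)] (I : MiND N P S L Dep) (s : S) {ρ : ℝ} (hρ : 0 < ρ)
    (hgrid : I.OnGrid ρ) {x : I.Trip → ℝ} {z : I.Trip → P → ℝ}
    (hx : ∀ tr, x tr ∈ ({0, 1} : Set ℝ)) (hz : ∀ tr p, z tr p ≤ 1) :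
    I.segmentValues s ρ {0, 1} x z ⊆ I.pathValues s {0, 1} x z := by
  rintro v ⟨ξ, β, hξ, hβ, hflow, hpax, hchk, hvis, hreg, rfl⟩
  choose ζ hζ hsum hcount hcost using fun tr => exists_path_of_time_flow hρ hgrid (hx tr) (hz tr)
    (hξ tr) (hβ tr) (hflow tr) (hpax tr) (hchk tr) (hvis tr) (hreg tr)
  exact ⟨ζ, hζ, hsum, fun tr p hp => (hcount tr p).trans_le (hpax tr p hp),
    Finset.sum_congr rfl fun tr _ => (hcost tr).symm⟩

end MiND

/-- Makes the integer programs an instance of the statements about `Set.Icc 0 1 ∩ G`; the next lemma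
does so for the relaxations. -/
lemma zero_one_eq_Icc_inter_int :
    ({0, 1} : Set ℝ) = Set.Icc 0 1 ∩ ((Int.castAddHom ℝ).range : AddSubgroup ℝ) := by
  ext r
  constructor
  · rintro (rfl | rfl)
    · exact ⟨by norm_num, 0, by simp⟩
    · exact ⟨by norm_num, 1, by simp⟩
  · rintro ⟨⟨h0, h1⟩, n, rfl⟩
    simp only [Int.coe_castAddHom] at h0 h1 ⊢
    have h2 : 0 ≤ n := by exact_mod_cast h0
    have h3 : n ≤ 1 := by exact_mod_cast h1
    interval_cases n <;> simp

lemma Icc_eq_Icc_inter_top : Set.Icc (0 : ℝ) 1 = Set.Icc 0 1 ∩ ((⊤ : AddSubgroup ℝ) : Set ℝ) := by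
  simp
end

theorem proposition2 {N P S L : Type*} {Dep : L → Type*} [Fintype N] [Fintype P] [Fintype S]
    [Fintype L] [∀ ℓ, Fintype (Dep ℓ)] (I : MiND N P S L Dep) :
    -- the path-based and the subpath-based integer programs are equivalent
    (∀ (s : S) (x : I.Trip → ℝ) (z : I.Trip → P → ℝ),
      (∀ tr, x tr ∈ ({0, 1} : Set ℝ)) → (∀ tr p, z tr p ∈ ({0, 1} : Set ℝ)) →
      I.pathValues s {0, 1} x z = I.subpathValues s {0, 1} x z) ∧
    -- and so are their linear relaxations
    (∀ (s : S) (x : I.Trip → ℝ) (z : I.Trip → P → ℝ),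
      (∀ tr, x tr ∈ Set.Icc (0 : ℝ) 1) → (∀ tr p, z tr p ∈ Set.Icc (0 : ℝ) 1) →
      I.pathValues s (Set.Icc 0 1) x z = I.subpathValues s (Set.Icc 0 1) x z) ∧
    -- if the scheduled times are multiples of some base unit, and every subpath takes strictly less
    -- than the scheduled time between its checkpoints, then there is a time step for which
    ((∃ b : ℝ, 0 < b ∧ I.OnGrid b) →
      (∀ (tr : I.Trip) (s : S) (r : I.Subpath tr s), r.time < I.T tr r.dst - I.T tr r.src) →
      ∃ ρ : ℝ, 0 < ρ ∧ I.OnGrid ρ ∧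
        -- the segment-based integer program is equivalent to the other two,
        (∀ (s : S) (x : I.Trip → ℝ) (z : I.Trip → P → ℝ),
          (∀ tr, x tr ∈ ({0, 1} : Set ℝ)) → (∀ tr p, z tr p ∈ ({0, 1} : Set ℝ)) →
          I.segmentValues s ρ {0, 1} x z = I.subpathValues s {0, 1} x z) ∧
        -- and its linear relaxation is at most as strong
        (∀ (s : S) (x : I.Trip → ℝ) (z : I.Trip → P → ℝ),
          (∀ tr, x tr ∈ Set.Icc (0 : ℝ) 1) → (∀ tr p, z tr p ∈ Set.Icc (0 : ℝ) 1) →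
          I.subpathValues s (Set.Icc 0 1) x z ⊆ I.segmentValues s ρ (Set.Icc 0 1) x z)) := by
  have hint : ∀ (s : S) (x : I.Trip → ℝ) (z : I.Trip → P → ℝ),
      (∀ tr, x tr ∈ ({0, 1} : Set ℝ)) →
      I.pathValues s {0, 1} x z = I.subpathValues s {0, 1} x z := by
    intro s x z hx
    rw [zero_one_eq_Icc_inter_int] at hx ⊢
    exact I.pathValues_eq_subpathValues s _ z hx
  have hrel : ∀ (s : S) (x : I.Trip → ℝ) (z : I.Trip → P → ℝ),
      (∀ tr, x tr ∈ Set.Icc (0 : ℝ) 1) →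
      I.pathValues s (Set.Icc 0 1) x z = I.subpathValues s (Set.Icc 0 1) x z := by
    intro s x z hx
    rw [Icc_eq_Icc_inter_top] at hx ⊢
    exact I.pathValues_eq_subpathValues s _ z hx
  refine ⟨fun s x z hx _ => hint s x z hx, fun s x z hx _ => hrel s x z hx, ?_⟩
  rintro ⟨b, hb, hgrid⟩ hslack
  obtain ⟨ρ, hρ, hgridρ, hround⟩ := I.exists_timeStep hb hgrid hslack
  refine ⟨ρ, hρ, hgridρ, fun s x z hx hz => ?_, fun s x z hx _ => ?_⟩
  -- The comparison passes through the path-based formulation. Reading paths off integral solutions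
  -- works for every positive step on the grid; embedding paths needs `hround`.
  · rw [← hint s x z hx]
    refine Set.Subset.antisymm (I.segmentValues_subset_pathValues s hρ hgridρ hx fun tr p => ?_) ?_
    · rcases hz tr p with h | (h : z tr p = 1) <;> linarith
    · rw [zero_one_eq_Icc_inter_int] at hx ⊢
      exact I.pathValues_subset_segmentValues s hρ hgridρ hround _ z fun tr => (hx tr).1.2
  · rw [← hrel s x z hx, Icc_eq_Icc_inter_top]
    exact I.pathValues_subset_segmentValues s hρ hgridρ hround _ z fun tr => (hx tr).2
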